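/- Let $G$ be a compact semisimple real Lie group with Lie algebra $\mathfrak g$ and Killing form $K$, and let $(\mathfrak g=\mathfrak h\oplus\mathfrak m,\,A)$ be a Hermitian symmetric structure: $[\mathfrak h,\mathfrak h]\subseteq\mathfrak h$, $[\mathfrak h,\mathfrak m]\subseteq\mathfrak m$, $[\mathfrak m,\mathfrak m]\subseteq\mathfrak h$, $\mathfrak m\neq 0$, the centralizer of $A$ in $\mathfrak g$ is $\mathfrak h$, and $\mathrm{ad}(A)^2=-\mathrm{id}$ on $\mathfrak m$. Let $H\subset G$ be the stabilizer of $A$ under $\mathrm{Ad}$. Let $\mathrm{Aff}(G,H)=(G\ltimes\mathfrak g)/G$, where $(g_1,a_1)(g_2,a_2)=(g_1g_2,\mathrm{Ad}(g_1)a_2+a_1)$; the space and its tangent spaces are identified with $\mathfrak g$. On $\mathfrak g_{\rm aff}=\mathfrak g\ltimes\mathfrak g$ use the bracket $[(a,a'),(b,b')]=([a,b],[a,b']+[a',b])$ and the inner product $\langle(a,a'),(b,b')\rangle=-K(a,b)-K(a',b')$; put $\mathfrak h_{\rm aff}=\{(a,0)\}$, $\mathfrak m_{\rm aff}=\{(0,a)\}$,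 $g(X,Y)=\langle(0,X),(0,Y)\rangle$ and $\chi=\langle(0,A),(0,A)\rangle$. A framing of a smooth curve flow $\gamma(x,t)$ in $\mathrm{Aff}(G,H)$, $(x,t)\in\mathbb R^2$, is a smooth map $\psi:\mathbb R^2\to G$, $(x,t)\mapsto\psi(x,t)$; its linear coframe and linear connection along $\gamma$ are $e=(0,\mathrm{Ad}(\psi^{-1})\,\cdot\,)$ and $\omega=(\psi^{-1}d\psi,0)$. Write $e_x=e\rfloor\gamma_x$, $e_t=e\rfloor\gamma_t$, $\omega_x=\omega\rfloor\gamma_x=(\psi^{-1}D_x\psi,0)$, $\omega_t=\omega\rfloor\gamma_t=(\psi^{-1}D_t\psi,0)$. Consider the flows in the class of $\chi^{-1/2}(0,A)$: at each $(x,t)$ there is $k\in G$ with $(0,\mathrm{Ad}(k^{-1})\gamma_x)=\chi^{-1/2}(0,A)$. A framing $\psi$ is called $G$-parallel if $e_x=\chi^{-1/2}(0,A)$ for all $(x,t)$ and $\omega_x$ always lies in the orthogonal complement, in $\mathfrak h_{\rm aff}$, of the centralizer of $e_x$ in $\mathfrak h_{\rm aff}$. Then: 1. $\chi=\dim\mathfrak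 m$; every coframe is isometric, $\langle (0,\mathrm{Ad}(k^{-1})X),(0,\mathrm{Ad}(k^{-1})Y)\rangle=g(X,Y)$ for $k\in G$; and $g(\gamma_x,\gamma_x)=1$ for every flow $\gamma$ in the class, so $\gamma$ is non-stretching with arclength $x$. 2. Every flow in the class has a $G$-parallel framing. 3. For every $G$-parallel framing of such a flow there are unique functions $q,h_\perp,w_\perp$ with values in $\mathfrak m$ and $h_\parallel,w_\parallel$ with values in $\mathfrak h$, and these are smooth, such that $$\omega_x=(q,0),\qquad e_t=(0,h_\parallel+h_\perp),\qquad \omega_t=(w_\parallel+w_\perp,0).$$ The structure equations $$D_xe_t-D_te_x+[\omega_x,e_t]-[\omega_t,e_x]=0,\qquad D_x\omega_t-D_t\omega_x+[\omega_x,\omega_t]=0$$ hold, and so do $$D_xh_\parallel+[q,h_\perp]=0,\qquad D_xh_\perp+[q,h_\parallel]+\chi^{-1/2}[A,w_\perp]=0,$$ $$D_xw_\parallel+[q,w_\perp]=0,\qquad D_xw_\perp-q_t+[q,w_\parallel]=0.$$ Moreover, for arbitrary smooth functions $q,h_\perp,w_\perp$ into $\mathfrak m$ and $h_\parallel,w_\parallel$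 into $\mathfrak h$, the structure equations with $e_x=\chi^{-1/2}(0,A)$ and $\omega_x,e_t,\omega_t$ as above are equivalent to these four equations. 4. The equivalence group is $H$: if $\psi$ is a $G$-parallel framing of $\gamma$, then for constant $k\in G$ the framing $\psi k$ is $G$-parallel if and only if $k\in H$; more generally, for smooth $k:\mathbb R^2\to G$, $\psi k$ is $G$-parallel if and only if $k$ is $H$-valued and independent of $x$. For constant $k\in H$, passing from $\psi$ to $\psi k$ applies $\mathrm{Ad}(k^{-1})$ to $q,h_\parallel,h_\perp,w_\parallel,w_\perp$. If $\gamma(x+l,t)=\gamma(x,t)$ for all $(x,t)$, then for every $t$ there is $k\in H$ with $\psi(x+l,t)=\psi(x,t)k$ for all $x$. 5. The four equations are $H$-invariant: for $k\in H$, applying $\mathrm{Ad}(k)$ to all of $q,h_\parallel,h_\perp,w_\parallel,w_\perp$ preserves their smoothness and their values in $\mathfrak m$, respectively $\mathfrak h$, and the transformed functions satisfy the four equations if and only if the original ones do. -/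

import Mathlib

open scoped Manifold ContDiff

noncomputable section

namespace AffHermitian

/-- Over `ℝ`, a smooth Lie group is regular enough for its Lie algebra to be defined. -/
instance instLEInftyMinSmoothness : ENat.LEInfty (minSmoothness ℝ 3) :=
  ⟨by
    rw [minSmoothness_of_isRCLikeNormedField]
    exact ENat.LEInfty.out⟩

/-! ### Hermitian symmetric Lie algebras -/

/-- A Hermitian symmetric structure on a real Lie algebra `L`: a symmetric decomposition
`L = h ⊕ m` together with an element `A` whose centralizer in `L` is `h` and for which `ad A`
squares to `-1` on `m`. The decomposition is nontrivial, `m ≠ 0`. -/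
structure HermitianSymmetric (L : Type*) [LieRing L] [LieAlgebra ℝ L] where
  h : LieSubalgebra ℝ L
  m : Submodule ℝ L
  A : L
  isCompl : IsCompl h.toSubmodule m
  lie_h_m : ∀ a ∈ h, ∀ b ∈ m, ⁅a, b⁆ ∈ m
  lie_m_m : ∀ a ∈ m, ∀ b ∈ m, ⁅a, b⁆ ∈ h
  centralizer_A : ∀ a : L, a ∈ h ↔ ⁅A, a⁆ = 0
  ad_A_sq : ∀ a ∈ m, ⁅A, ⁅A, a⁆⁆ = -a
  m_ne_bot : m ≠ ⊥

/-! ### The semidirect Lie algebra `L ⋊ L`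

Its elements are the pairs `(a, a')`; the first slot is the linear (rotation) part `h_aff`, the
second slot is the translation part `m_aff`. -/

section AffineAlgebra

variable {L : Type*} [LieRing L] [LieAlgebra ℝ L]

/-- The bracket of `L ⋊ L`: `[(a, a'), (b, b')] = ([a, b], [a, b'] + [a', b])`. -/
def affBracket (u v : L × L) : L × L := (⁅u.1, v.1⁆, ⁅u.1, v.2⁆ + ⁅u.2, v.1⁆)

/-- The inner product `⟨(a, a'), (b, b')⟩ = -K(a, b) - K(a', b')`, `K` the Killing form of `L`. -/
def affInner (u v : L × L) : ℝ := -killingForm ℝ L u.1 v.1 - killingForm ℝ L u.2 v.2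

/-- The centralizer of `e` in the subalgebra `h_aff = {(a, 0)}`. -/
def hAffPar (e : L × L) : Set (L × L) := {u | u.2 = 0 ∧ affBracket e u = 0}

/-- The orthogonal complement, inside `h_aff = {(a, 0)}`, of the centralizer of `e`. -/
def hAffPerp (e : L × L) : Set (L × L) := {u | u.2 = 0 ∧ ∀ v ∈ hAffPar e, affInner u v = 0}

/-- `χ = ⟨(0, A), (0, A)⟩`. -/
def HermitianSymmetric.chi (S : HermitianSymmetric L) : ℝ := affInner (0, S.A) (0, S.A)

/-- The element `χ^{-1/2} (0, A)` of `m_aff`. -/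
def HermitianSymmetric.e (S : HermitianSymmetric L) : L × L := (√S.chi)⁻¹ • (0, S.A)

end AffineAlgebra

/-! ### The adjoint representation of a Lie group -/

section Group

variable (E : Type*) [NormedAddCommGroup E] [NormedSpace ℝ E]
  {G : Type*} [TopologicalSpace G] [ChartedSpace E G] [Group G]

/-- `Ad g` is the derivative at `1` of the conjugation `z ↦ g z g⁻¹`. -/
def Ad (g : G) : GroupLieAlgebra 𝓘(ℝ, E) G →L[ℝ] GroupLieAlgebra 𝓘(ℝ, E) G :=
  mfderiv 𝓘(ℝ, E) 𝓘(ℝ, E) (fun z : G => g * z * g⁻¹) 1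

theorem Ad_one : Ad E (1 : G) = ContinuousLinearMap.id ℝ _ := by
  have : (fun z : G => (1 : G) * z * (1 : G)⁻¹) = id := by ext z; simp
  unfold Ad
  rw [this]
  exact mfderiv_id

variable [LieGroup 𝓘(ℝ, E) ∞ G]

theorem mdifferentiable_conj (g : G) :
    MDifferentiable 𝓘(ℝ, E) 𝓘(ℝ, E) (fun z : G => g * z * g⁻¹) := by
  have h : ContMDiff 𝓘(ℝ, E) 𝓘(ℝ, E) ∞ (fun z : G => g * z * g⁻¹) :=
    (contMDiff_const.mul contMDiff_id).mul contMDiff_const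
  exact h.mdifferentiable (by simp)

theorem Ad_mul (g k : G) : Ad E (g * k) = (Ad E g).comp (Ad E k) := by
  have hc : (fun z : G => (g * k) * z * (g * k)⁻¹)
      = (fun z : G => g * z * g⁻¹) ∘ (fun z : G => k * z * k⁻¹) := by
    ext z; simp [mul_assoc]
  have h1 : k * 1 * k⁻¹ = 1 := by simp
  unfold Ad
  rw [hc, mfderiv_comp (I' := 𝓘(ℝ, E)) _ (mdifferentiable_conj E g _)
    (mdifferentiable_conj E k _), h1]
  rfl

/-- The adjoint action as a homomorphism to the automorphisms of the additive group of the Lie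
algebra (written multiplicatively, as the semidirect product requires). -/
def AdHom : G →* MulAut (Multiplicative (GroupLieAlgebra 𝓘(ℝ, E) G)) where
  toFun g := AddEquiv.toMultiplicative
    { toFun := Ad E g
      invFun := Ad E g⁻¹
      left_inv := fun a => by
        rw [← ContinuousLinearMap.comp_apply, ← Ad_mul, inv_mul_cancel, Ad_one]
        rfl
      right_inv := fun a => by
        rw [← ContinuousLinearMap.comp_apply, ← Ad_mul, mul_inv_cancel, Ad_one]
        rfl
      map_add' := fun a b => map_add _ a b }
  map_one' := by
    ext a
    change Multiplicative.ofAdd (Ad E (1 : G) (Multiplicative.toAdd a)) = a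
    rw [Ad_one]
    rfl
  map_mul' g k := by
    ext a
    change Multiplicative.ofAdd (Ad E (g * k) (Multiplicative.toAdd a)) =
      Multiplicative.ofAdd (Ad E g (Ad E k (Multiplicative.toAdd a)))
    rw [Ad_mul]
    rfl

/-- The stabilizer of a Lie algebra element under the adjoint action. -/
def stabilizer (A : GroupLieAlgebra 𝓘(ℝ, E) G) : Subgroup G where
  carrier := {g | Ad E g A = A}
  one_mem' := by
    change Ad E (1 : G) A = A
    rw [Ad_one]
    rfl
  mul_mem' {g k} hg hk := by
    change Ad E (g * k) A = A
    rw [Ad_mul, ContinuousLinearMap.comp_apply, show Ad E k A = A from hk]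
    exact hg
  inv_mem' {g} hg := by
    change Ad E g⁻¹ A = A
    have hg' : Ad E g A = A := hg
    conv_lhs => rw [← hg']
    rw [← ContinuousLinearMap.comp_apply, ← Ad_mul, inv_mul_cancel, Ad_one]
    rfl

/-! ### The affine space `(G ⋉ L) / G` -/

variable (G) in
/-- The group `G ⋉ L`, with `(a₁, g₁)(a₂, g₂) = (a₁ + Ad(g₁) a₂, g₁ g₂)`. -/
abbrev AffGroup : Type _ := Multiplicative (GroupLieAlgebra 𝓘(ℝ, E) G) ⋊[AdHom E] G

variable (G) in
/-- The affine symmetric space `(G ⋉ L) / G`. -/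
abbrev Aff : Type _ :=
  AffGroup E G ⧸ (SemidirectProduct.inr : G →* AffGroup E G).range

variable (G) in
/-- The coset of `(a, g)` is determined by `a`; this identifies `(G ⋉ L) / G` with the vector space
`L`. It is the global chart that gives the space its manifold structure, and it identifies
each of its tangent spaces with `L`. -/
def Aff.chart : Aff E G ≃ GroupLieAlgebra 𝓘(ℝ, E) G where
  toFun := Quotient.lift (fun p : AffGroup E G => Multiplicative.toAdd p.left) (by
    intro p r hpr
    obtain ⟨k, hk⟩ := QuotientGroup.leftRel_apply.mp hpr
    have hr : r = p * SemidirectProduct.inr k := by rw [hk]; group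
    rw [hr]
    simp)
  invFun a := QuotientGroup.mk (SemidirectProduct.inl (Multiplicative.ofAdd a))
  left_inv := by
    intro p
    induction p using QuotientGroup.induction_on with
    | H p =>
      refine QuotientGroup.eq.mpr ⟨p.right, ?_⟩
      change _ = (SemidirectProduct.inl p.left : AffGroup E G)⁻¹ * p
      rw [eq_inv_mul_iff_mul_eq, SemidirectProduct.inl_left_mul_inr_right]
  right_inv a := by
    change Multiplicative.toAdd (SemidirectProduct.left
      (SemidirectProduct.inl (Multiplicative.ofAdd a) : AffGroup E G)) = a
    simp

/-! ### Derivatives of functions of `(x, t)` -/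

variable {E}

/-- `D_x F` for an `L`-valued function `F(x, t)`. -/
def dx (F : ℝ → ℝ → GroupLieAlgebra 𝓘(ℝ, E) G) (x t : ℝ) : GroupLieAlgebra 𝓘(ℝ, E) G :=
  deriv (F := E) (fun s => F s t) x

/-- `D_t F` for an `L`-valued function `F(x, t)`. -/
def dt (F : ℝ → ℝ → GroupLieAlgebra 𝓘(ℝ, E) G) (x t : ℝ) : GroupLieAlgebra 𝓘(ℝ, E) G :=
  deriv (F := E) (fun s => F x s) t

/-- `D_x F` for an `(L ⋊ L)`-valued function. -/
def dxAff (F : ℝ → ℝ → GroupLieAlgebra 𝓘(ℝ, E) G × GroupLieAlgebra 𝓘(ℝ, E) G) (x t : ℝ) :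
    GroupLieAlgebra 𝓘(ℝ, E) G × GroupLieAlgebra 𝓘(ℝ, E) G :=
  (dx (fun x t => (F x t).1) x t, dx (fun x t => (F x t).2) x t)

/-- `D_t F` for an `(L ⋊ L)`-valued function. -/
def dtAff (F : ℝ → ℝ → GroupLieAlgebra 𝓘(ℝ, E) G × GroupLieAlgebra 𝓘(ℝ, E) G) (x t : ℝ) :
    GroupLieAlgebra 𝓘(ℝ, E) G × GroupLieAlgebra 𝓘(ℝ, E) G :=
  (dt (fun x t => (F x t).1) x t, dt (fun x t => (F x t).2) x t)

/-- Smoothness of an `L`-valued function of `(x, t)`. -/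
def SmoothLie (F : ℝ → ℝ → GroupLieAlgebra 𝓘(ℝ, E) G) : Prop :=
  ContDiff ℝ ∞ (F := E) (fun p : ℝ × ℝ => F p.1 p.2)

variable (E) in
/-- Smoothness of a `G`-valued function of `(x, t)`. -/
def SmoothGroup (ψ : ℝ → ℝ → G) : Prop :=
  ContMDiff 𝓘(ℝ, ℝ × ℝ) 𝓘(ℝ, E) ∞ (fun p : ℝ × ℝ => ψ p.1 p.2)

variable (E) in
/-- `ψ⁻¹ D_x ψ`, the velocity at `s = x` of the curve `s ↦ ψ(x, t)⁻¹ ψ(s, t)` through `1`. -/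
def logDx (ψ : ℝ → ℝ → G) (x t : ℝ) : GroupLieAlgebra 𝓘(ℝ, E) G :=
  mfderiv 𝓘(ℝ, ℝ) 𝓘(ℝ, E) (fun s : ℝ => (ψ x t)⁻¹ * ψ s t) x (1 : ℝ)

variable (E) in
/-- `ψ⁻¹ D_t ψ`, the velocity at `s = t` of the curve `s ↦ ψ(x, t)⁻¹ ψ(x, s)` through `1`. -/
def logDt (ψ : ℝ → ℝ → G) (x t : ℝ) : GroupLieAlgebra 𝓘(ℝ, E) G :=
  mfderiv 𝓘(ℝ, ℝ) 𝓘(ℝ, E) (fun s : ℝ => (ψ x t)⁻¹ * ψ x s) t (1 : ℝ)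

/-! ### Curve flows, coframes and connections -/

/-- A smooth flow `γ(x, t)` of curves in the affine space. -/
def SmoothFlow (γ : ℝ → ℝ → Aff E G) : Prop := SmoothLie (fun x t => Aff.chart E G (γ x t))

/-- The tangent vector `γ_x`. -/
def tangentX (γ : ℝ → ℝ → Aff E G) : ℝ → ℝ → GroupLieAlgebra 𝓘(ℝ, E) G :=
  dx (fun x t => Aff.chart E G (γ x t))

/-- The flow vector `γ_t`. -/
def tangentT (γ : ℝ → ℝ → Aff E G) : ℝ → ℝ → GroupLieAlgebra 𝓘(ℝ, E) G :=
  dt (fun x t => Aff.chart E G (γ x t))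

/-- The linear coframe attached to the group element `g`: `X ↦ (0, Ad(g⁻¹) X)`. -/
def coframe (g : G) (X : GroupLieAlgebra 𝓘(ℝ, E) G) :
    GroupLieAlgebra 𝓘(ℝ, E) G × GroupLieAlgebra 𝓘(ℝ, E) G := (0, Ad E g⁻¹ X)

variable (E) in
/-- The linear connection `(ψ⁻¹ dψ, 0)` contracted with the tangent vector of the flow. -/
def connX (ψ : ℝ → ℝ → G) (x t : ℝ) : GroupLieAlgebra 𝓘(ℝ, E) G × GroupLieAlgebra 𝓘(ℝ, E) G :=
  (logDx E ψ x t, 0)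

variable (E) in
/-- The linear connection `(ψ⁻¹ dψ, 0)` contracted with the flow vector. -/
def connT (ψ : ℝ → ℝ → G) (x t : ℝ) : GroupLieAlgebra 𝓘(ℝ, E) G × GroupLieAlgebra 𝓘(ℝ, E) G :=
  (logDt E ψ x t, 0)

variable [CompleteSpace E]

/-- The Riemannian metric of the affine space. -/
def metric (X Y : GroupLieAlgebra 𝓘(ℝ, E) G) : ℝ := affInner (0, X) (0, Y)

/-- The Maurer-Cartan (torsion and curvature) equations
`D_x e_t - D_t e_x + [ω_x, e_t] - [ω_t, e_x] = 0` and `D_x ω_t - D_t ω_x + [ω_x, ω_t] = 0`. -/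
def StructureEqs
    (ex et wx wt : ℝ → ℝ → GroupLieAlgebra 𝓘(ℝ, E) G × GroupLieAlgebra 𝓘(ℝ, E) G) : Prop :=
  (∀ x t, dxAff et x t - dtAff ex x t + affBracket (wx x t) (et x t)
    - affBracket (wt x t) (ex x t) = 0) ∧
  (∀ x t, dxAff wt x t - dtAff wx x t + affBracket (wx x t) (wt x t) = 0)

/-- `ψ` is a `G`-parallel framing of the flow `γ` with `e⌟γ_x = χ^{-1/2} (0, A)`: a smooth
`G`-valued function along the flow, whose coframe takes the tangent vector to the constant
`e_x = χ^{-1/2} (0, A)` and whose connection `ω⌟γ_x` lies in the perp space of the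
centralizer of `e_x` in `h_aff`. -/
structure IsGParallelFraming (S : HermitianSymmetric (GroupLieAlgebra 𝓘(ℝ, E) G))
    (γ : ℝ → ℝ → Aff E G) (ψ : ℝ → ℝ → G) : Prop where
  smooth : SmoothGroup E ψ
  adapted : ∀ x t, coframe (ψ x t) (tangentX γ x t) = S.e
  parallel : ∀ x t, connX E ψ x t ∈ hAffPerp S.e

/-! ### The variables of a `G`-parallel framing -/

variable (E G) in
/-- The five functions `q, h_∥, h_⊥, w_∥, w_⊥` of `(x, t)`. -/
@[ext] structure FrameVars where
  q : ℝ → ℝ → GroupLieAlgebra 𝓘(ℝ, E) G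
  hpar : ℝ → ℝ → GroupLieAlgebra 𝓘(ℝ, E) G
  hperp : ℝ → ℝ → GroupLieAlgebra 𝓘(ℝ, E) G
  wpar : ℝ → ℝ → GroupLieAlgebra 𝓘(ℝ, E) G
  wperp : ℝ → ℝ → GroupLieAlgebra 𝓘(ℝ, E) G

namespace FrameVars

/-- `q, h_⊥, w_⊥` take values in `m`, and `h_∥, w_∥` take values in `h`. -/
structure Valued (S : HermitianSymmetric (GroupLieAlgebra 𝓘(ℝ, E) G)) (V : FrameVars E G) :
    Prop where
  q_mem : ∀ x t, V.q x t ∈ S.m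
  hpar_mem : ∀ x t, V.hpar x t ∈ S.h
  hperp_mem : ∀ x t, V.hperp x t ∈ S.m
  wpar_mem : ∀ x t, V.wpar x t ∈ S.h
  wperp_mem : ∀ x t, V.wperp x t ∈ S.m

structure Smooth (V : FrameVars E G) : Prop where
  q_smooth : SmoothLie V.q
  hpar_smooth : SmoothLie V.hpar
  hperp_smooth : SmoothLie V.hperp
  wpar_smooth : SmoothLie V.wpar
  wperp_smooth : SmoothLie V.wperp

/-- `ω⌟γ_x = (q, 0)`, `e⌟γ_t = (0, h_∥ + h_⊥)`, `ω⌟γ_t = (w_∥ + w_⊥, 0)`. -/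
structure Represents (V : FrameVars E G) (γ : ℝ → ℝ → Aff E G) (ψ : ℝ → ℝ → G) : Prop where
  connX_eq : ∀ x t, connX E ψ x t = (V.q x t, 0)
  coframeT_eq : ∀ x t, coframe (ψ x t) (tangentT γ x t) = (0, V.hpar x t + V.hperp x t)
  connT_eq : ∀ x t, connT E ψ x t = (V.wpar x t + V.wperp x t, 0)

/-- The four reduced frame structure equations. -/
structure FlowEqs (S : HermitianSymmetric (GroupLieAlgebra 𝓘(ℝ, E) G)) (V : FrameVars E G) :
    Prop where
  mpar : ∀ x t, dx V.hpar x t + ⁅V.q x t, V.hperp x t⁆ = 0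
  mperp : ∀ x t, dx V.hperp x t + ⁅V.q x t, V.hpar x t⁆ + (√S.chi)⁻¹ • ⁅S.A, V.wperp x t⁆ = 0
  hpar : ∀ x t, dx V.wpar x t + ⁅V.q x t, V.wperp x t⁆ = 0
  hperp : ∀ x t, dx V.wperp x t - dt V.q x t + ⁅V.q x t, V.wpar x t⁆ = 0

/-- The action of a constant group element by `Ad k` on all five functions. -/
def act (k : G) (V : FrameVars E G) : FrameVars E G where
  q x t := Ad E k (V.q x t)
  hpar x t := Ad E k (V.hpar x t)
  hperp x t := Ad E k (V.hperp x t)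
  wpar x t := Ad E k (V.wpar x t)
  wperp x t := Ad E k (V.wperp x t)

end FrameVars

end Group

end AffHermitian

end

/-!
The normalized element `e = χ^{-1/2} A` satisfies `(ad e)³ = -χ⁻¹ ad e`, because `ad A` vanishes on
`h` and is a complex structure on `m`. A framing `ψ` has `e_x = e` when `T = γ_x` equals `Ad(ψ) e`.
Linearizing the cubic relation along the adjoint orbit of `e` shows that `Ad(ψ⁻¹) T_x` lies in `m`,
so that `(ad T)² T_x = -χ⁻¹ T_x`. Hence a solution of `ψ_x ψ⁻¹ = χ [T, T_x]` that carries `e` to `T`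
at one point of a line `t = const` does so along the whole line, and then `ψ⁻¹ ψ_x` lies in `m`.
Parallel framings are obtained by solving this equation first along the `t`-axis, to have smooth
initial values, and then along the lines `t = const`. Smooth dependence on the initial values comes
from the implicit function theorem applied to the integral equation.

The structure equations say that mixed partial derivatives commute, for `γ` in the coframe and for
`ψ` in a chart (the Maurer–Cartan equation), and the four flow equations are their components in
`h` and `m`. The equivalence group is `H` since the connection of `ψ k` is
`Ad(k⁻¹) (ψ⁻¹ ψ_x) + k⁻¹ k_x`: where `k` fixes `A` the first term lies in `m` and the second in `h`,
so `k⁻¹ k_x` lies in `h ∩ m = 0`.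
-/

open scoped Topology

noncomputable section

namespace AffHermitian

section

/-! ### Hermitian symmetric Lie algebras: projections and the normalized element -/

variable {L : Type*} [LieRing L] [LieAlgebra ℝ L]

theorem eq_zero_of_forall_killingForm [LieAlgebra.IsKilling ℝ L] {a : L}
    (h : ∀ b, killingForm ℝ L a b = 0) : a = 0 := by
  have ha : a ∈ LinearMap.ker (killingForm ℝ L) := LinearMap.ext h
  rwa [LieAlgebra.IsKilling.ker_killingForm_eq_bot, Submodule.mem_bot] at ha

theorem eq_zero_of_forall_lie [LieAlgebra.IsKilling ℝ L] {a : L}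
    (h : ∀ b : L, ⁅a, b⁆ = 0) : a = 0 := by
  refine eq_zero_of_forall_killingForm fun b => ?_
  have : LieAlgebra.ad ℝ L a = 0 := LinearMap.ext h
  rw [killingForm_apply_apply, this, LinearMap.zero_comp, map_zero]

namespace HermitianSymmetric

variable (S : HermitianSymmetric L)

theorem lie_A_of_mem_h {a : L} (ha : a ∈ S.h) : ⁅S.A, a⁆ = 0 := (S.centralizer_A a).1 ha

theorem A_mem_h : S.A ∈ S.h := (S.centralizer_A _).2 (lie_self _)

theorem lie_A_mem_m {a : L} (ha : a ∈ S.m) : ⁅S.A, a⁆ ∈ S.m := S.lie_h_m _ S.A_mem_h _ ha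

theorem lie_m_h {a b : L} (ha : a ∈ S.m) (hb : b ∈ S.h) : ⁅a, b⁆ ∈ S.m := by
  rw [← lie_skew]
  exact S.m.neg_mem (S.lie_h_m _ hb _ ha)

theorem eq_zero_of_mem {a : L} (ha : a ∈ S.h) (hb : a ∈ S.m) : a = 0 :=
  Submodule.disjoint_def.1 S.isCompl.disjoint a ha hb

theorem exists_add (a : L) : ∃ b ∈ S.h, ∃ c ∈ S.m, b + c = a :=
  Submodule.mem_sup.1 (S.isCompl.sup_eq_top ▸ Submodule.mem_top)

theorem add_eq_add_iff {a b c d : L} (ha : a ∈ S.h) (hb : b ∈ S.m) (hc : c ∈ S.h) (hd : d ∈ S.m) :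
    a + b = c + d ↔ a = c ∧ b = d := by
  refine ⟨fun h => ?_, fun h => by rw [h.1, h.2]⟩
  have hdiff : a - c = d - b := by
    rw [sub_eq_sub_iff_add_eq_add, h, add_comm]
  have hzero : a - c = 0 := S.eq_zero_of_mem (S.h.sub_mem ha hc) (hdiff ▸ S.m.sub_mem hd hb)
  exact ⟨sub_eq_zero.1 hzero, (sub_eq_zero.1 (hdiff ▸ hzero)).symm⟩

theorem add_eq_zero_iff {a b : L} (ha : a ∈ S.h) (hb : b ∈ S.m) : a + b = 0 ↔ a = 0 ∧ b = 0 := by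
  simpa using S.add_eq_add_iff ha hb S.h.zero_mem S.m.zero_mem

/-- The projection onto `m` along `h`, as an endomorphism of `L`; it gives the perp variables of a
framing. -/
def projM : L →ₗ[ℝ] L := S.m.projection S.h.toSubmodule S.isCompl.symm

/-- The projection onto `h` along `m`, as an endomorphism of `L`; it gives the parallel variables of
a framing. -/
def projH : L →ₗ[ℝ] L := S.h.toSubmodule.projection S.m S.isCompl

theorem projM_mem (a : L) : S.projM a ∈ S.m := Submodule.projection_apply_mem _ a

theorem projM_of_mem_m {a : L} (ha : a ∈ S.m) : S.projM a = a :=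
  Submodule.projection_apply_of_mem_left _ ha

theorem projM_of_mem_h {a : L} (ha : a ∈ S.h) : S.projM a = 0 :=
  (Submodule.projection_apply_eq_zero_iff _).2 ha

theorem projH_mem (a : L) : S.projH a ∈ S.h := Submodule.projection_apply_mem _ a

theorem projH_of_mem_h {a : L} (ha : a ∈ S.h) : S.projH a = a :=
  Submodule.projection_apply_of_mem_left _ ha

theorem projH_of_mem_m {a : L} (ha : a ∈ S.m) : S.projH a = 0 :=
  (Submodule.projection_apply_eq_zero_iff _).2 ha

theorem projH_add_projM (a : L) : S.projH a + S.projM a = a :=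
  Submodule.projection_add_projection_eq_self _ a

theorem lie_A_lie_A (a : L) : ⁅S.A, ⁅S.A, a⁆⁆ = -S.projM a := by
  obtain ⟨b, hb, c, hc, rfl⟩ := S.exists_add a
  simp [S.projM_of_mem_h hb, S.projM_of_mem_m hc, S.lie_A_of_mem_h hb, S.ad_A_sq c hc]

theorem A_lie_triple (a : L) : ⁅S.A, ⁅S.A, ⁅S.A, a⁆⁆⁆ = -⁅S.A, a⁆ := by
  obtain ⟨b, hb, c, hc, rfl⟩ := S.exists_add a
  simp only [lie_add, S.lie_A_of_mem_h hb, zero_add]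
  rw [S.ad_A_sq c hc, lie_neg]

theorem killingForm_h_m {a b : L} (ha : a ∈ S.h) (hb : b ∈ S.m) : killingForm ℝ L a b = 0 := by
  have hb_eq : b = -⁅S.A, ⁅S.A, b⁆⁆ := by rw [S.ad_A_sq b hb, neg_neg]
  rw [hb_eq, map_neg, killingForm, ← LieModule.traceForm_apply_lie_apply, ← lie_skew,
    S.lie_A_of_mem_h ha]
  simp

/-- The normalized element `χ^{-1/2} A`, that is, the second slot of `S.e`. -/
def e₂ : L := (√S.chi)⁻¹ • S.A

theorem e_eq : S.e = (0, S.e₂) := by simp [e, e₂]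

theorem lie_e₂_of_mem_h {a : L} (ha : a ∈ S.h) : ⁅S.e₂, a⁆ = 0 := by
  simp [e₂, S.lie_A_of_mem_h ha]

theorem lie_e₂_mem_m {a : L} (ha : a ∈ S.m) : ⁅S.e₂, a⁆ ∈ S.m := by
  rw [e₂, smul_lie]
  exact S.m.smul_mem _ (S.lie_A_mem_m ha)

section Finite

variable [FiniteDimensional ℝ L]

theorem chi_eq_finrank : S.chi = Module.finrank ℝ S.m := by
  have hproj : LinearMap.IsProj S.m S.projM := ⟨S.projM_mem, fun a ha => S.projM_of_mem_m ha⟩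
  have had_sq : LieAlgebra.ad ℝ L S.A ∘ₗ LieAlgebra.ad ℝ L S.A = -S.projM := by
    ext a
    simpa using S.lie_A_lie_A a
  rw [chi, affInner, ← hproj.trace]
  simp only [killingForm_apply_apply, had_sq, map_neg, map_zero, neg_zero]
  ring

theorem chi_pos : 0 < S.chi := by
  have : Nontrivial S.m := Submodule.nontrivial_iff_ne_bot.2 S.m_ne_bot
  rw [chi_eq_finrank]
  exact_mod_cast Module.finrank_pos

theorem inv_sqrt_chi_pos : 0 < (√S.chi)⁻¹ := inv_pos.2 (Real.sqrt_pos.2 S.chi_pos)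

theorem inv_sqrt_chi_sq : (√S.chi)⁻¹ * (√S.chi)⁻¹ = S.chi⁻¹ := by
  rw [← mul_inv, Real.mul_self_sqrt S.chi_pos.le]

theorem mem_h_iff_lie_e₂ (a : L) : a ∈ S.h ↔ ⁅S.e₂, a⁆ = 0 := by
  rw [e₂, smul_lie, smul_eq_zero_iff_right S.inv_sqrt_chi_pos.ne', S.centralizer_A]

theorem lie_e₂_lie_e₂ {a : L} (ha : a ∈ S.m) : ⁅S.e₂, ⁅S.e₂, a⁆⁆ = -(S.chi⁻¹ • a) := by
  simp only [e₂, smul_lie, lie_smul, smul_smul, S.ad_A_sq a ha, S.inv_sqrt_chi_sq, smul_neg]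

theorem e₂_lie_triple (a : L) : ⁅S.e₂, ⁅S.e₂, ⁅S.e₂, a⁆⁆⁆ = -(S.chi⁻¹ • ⁅S.e₂, a⁆) := by
  simp only [e₂, smul_lie, lie_smul, S.A_lie_triple, smul_neg, smul_smul, ← S.inv_sqrt_chi_sq]

theorem affInner_e : affInner S.e S.e = 1 := by
  have h : affInner S.e S.e = ((√S.chi)⁻¹ * (√S.chi)⁻¹) * S.chi := by
    simp only [e, affInner, chi, Prod.smul_fst, Prod.smul_snd, map_smul, LinearMap.smul_apply,
      smul_eq_mul]
    ring
  rw [h, S.inv_sqrt_chi_sq, inv_mul_cancel₀ S.chi_pos.ne']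

theorem mem_hAffPar_iff (u : L × L) : u ∈ hAffPar S.e ↔ u.2 = 0 ∧ u.1 ∈ S.h := by
  rw [S.mem_h_iff_lie_e₂, hAffPar, Set.mem_ofPred_eq]
  refine and_congr_right fun _ => ?_
  simp [affBracket, S.e_eq, Prod.ext_iff]

variable [LieAlgebra.IsKilling ℝ L]

theorem mem_hAffPerp_iff (u : L × L) : u ∈ hAffPerp S.e ↔ u.2 = 0 ∧ u.1 ∈ S.m := by
  rw [hAffPerp, Set.mem_ofPred_eq]
  refine and_congr_right fun hu => ⟨fun h => ?_, fun h v hv => ?_⟩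
  · obtain ⟨b, hb, c, hc, hbc⟩ := S.exists_add u.1
    have hb0 : b = 0 := by
      refine eq_zero_of_forall_killingForm fun y => ?_
      obtain ⟨y₁, hy₁, y₂, hy₂, rfl⟩ := S.exists_add y
      have hinner := h (y₁, 0) ((S.mem_hAffPar_iff _).2 ⟨rfl, hy₁⟩)
      have hcy : killingForm ℝ L c y₁ = 0 := by
        rw [LieModule.traceForm_comm]
        exact S.killingForm_h_m hy₁ hc
      simp only [affInner, hu, ← hbc, map_add, LinearMap.add_apply, hcy, map_zero] at hinner
      rw [map_add, S.killingForm_h_m hb hy₂]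
      linarith
    rw [← hbc, hb0, zero_add]
    exact hc
  · rw [S.mem_hAffPar_iff] at hv
    have huv : killingForm ℝ L u.1 v.1 = 0 := by
      rw [LieModule.traceForm_comm]
      exact S.killingForm_h_m hv.2 h
    simp [affInner, hu, huv]

/-- The hypothesis is the relation `(ad e)³ = -χ⁻¹ ad e` of `e₂_lie_triple` linearized at `e₂` in
the direction `v`, so it holds for the velocities of curves in the adjoint orbit of `e₂`. -/
theorem mem_m_of_linearized {v : L}
    (hv : ∀ x : L, ⁅v, ⁅S.e₂, ⁅S.e₂, x⁆⁆⁆ + ⁅S.e₂, ⁅v, ⁅S.e₂, x⁆⁆⁆ + ⁅S.e₂, ⁅S.e₂, ⁅v, x⁆⁆⁆ =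
      -(S.chi⁻¹ • ⁅v, x⁆)) : v ∈ S.m := by
  obtain ⟨b, hb, c, hc, rfl⟩ := S.exists_add v
  have hchi : S.chi⁻¹ ≠ 0 := inv_ne_zero S.chi_pos.ne'
  suffices hb0 : b = 0 by rw [hb0, zero_add]; exact hc
  refine eq_zero_of_forall_lie fun x => ?_
  obtain ⟨y, hy, z, hz, rfl⟩ := S.exists_add x
  have hby : ⁅b, y⁆ = 0 := by
    have h := hv y
    have hbe : ⁅S.e₂, ⁅b, y⁆⁆ = 0 := S.lie_e₂_of_mem_h (S.h.lie_mem hb hy)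
    rw [S.lie_e₂_of_mem_h hy, lie_zero, lie_zero, zero_add, lie_zero, zero_add, add_lie,
      lie_add, hbe, zero_add, S.lie_e₂_lie_e₂ (S.lie_m_h hc hy), smul_add, neg_add,
      right_eq_add, neg_eq_zero] at h
    exact (smul_eq_zero_iff_right hchi).1 h
  have hbz : ⁅b, z⁆ = 0 := by
    have h := hv z
    have hbz_mem := S.lie_h_m b hb z hz
    have hc1 : ⁅S.e₂, ⁅c, ⁅S.e₂, z⁆⁆⁆ = 0 :=
      S.lie_e₂_of_mem_h (S.lie_m_m _ hc _ (S.lie_e₂_mem_m hz))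
    have hc2 : ⁅S.e₂, ⁅c, z⁆⁆ = 0 := S.lie_e₂_of_mem_h (S.lie_m_m _ hc _ hz)
    have hb1 : ⁅b, ⁅S.e₂, z⁆⁆ = ⁅S.e₂, ⁅b, z⁆⁆ := by
      rw [leibniz_lie S.e₂ b z, S.lie_e₂_of_mem_h hb, zero_lie, zero_add]
    rw [S.lie_e₂_lie_e₂ hz, lie_neg, lie_smul, add_assoc, add_eq_left, add_lie, add_lie, lie_add,
      lie_add, hc1, hc2, add_zero, add_zero, hb1, S.lie_e₂_lie_e₂ hbz_mem, ← two_smul ℝ, smul_neg,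
      neg_eq_zero, smul_smul] at h
    exact (smul_eq_zero_iff_right (mul_ne_zero two_ne_zero hchi)).1 h
  rw [lie_add, hby, hbz, add_zero]

end Finite

end HermitianSymmetric

end

section

/-! ### Logarithmic derivatives and the adjoint action -/

variable {E : Type*} [NormedAddCommGroup E] [NormedSpace ℝ E]

theorem SmoothGroup.swap {G : Type*} [TopologicalSpace G] [ChartedSpace E G] {ψ : ℝ → ℝ → G}
    (hψ : SmoothGroup E ψ) : SmoothGroup E (fun t x => ψ x t) :=
  hψ.comp (contDiff_snd.prodMk contDiff_fst).contMDiff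

variable {G : Type*} [TopologicalSpace G] [ChartedSpace E G] [Group G]

variable (E) in
/-- The velocity of a curve in the group, as an element of the model space: all tangent spaces
are copies of `E`, which unlike `GroupLieAlgebra` carries a norm. -/
def velocity (a : ℝ → G) (x : ℝ) : E := mfderiv 𝓘(ℝ, ℝ) 𝓘(ℝ, E) a x (1 : ℝ)

variable (E) in
/-- The logarithmic derivative `f⁻¹ f'` of a curve, read in the model space: the velocity at `x`
of the curve `s ↦ f(x)⁻¹ f(s)` through `1`. -/
def logDeriv (f : ℝ → G) (x : ℝ) : E := velocity E (fun s => (f x)⁻¹ * f s) x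

variable (E) in
/-- The adjoint action, as a family of endomorphisms of the model space. -/
def AdE (g : G) : E →L[ℝ] E := Ad E g

/-- The derivative at `1` of a vector valued function on the group. -/
def mfderivOne {W : Type*} [NormedAddCommGroup W] [NormedSpace ℝ W] (Φ : G → W) : E →L[ℝ] W :=
  mfderiv 𝓘(ℝ, E) 𝓘(ℝ, W) Φ 1

variable (E G) in
/-- The Lie bracket on the model space, introduced as the derivative at `1` of the adjoint
action; `adE_apply` identifies it with the bracket of left invariant vector fields. -/
def adE : E →L[ℝ] E →L[ℝ] E := mfderivOne (AdE E : G → E →L[ℝ] E)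

theorem logDeriv_const_mul (f : ℝ → G) (g : G) (x : ℝ) :
    logDeriv E (fun s => g * f s) x = logDeriv E f x := by
  simp only [logDeriv, mul_inv_rev, mul_assoc, inv_mul_cancel_left]

theorem AdE_one : AdE E (1 : G) = ContinuousLinearMap.id ℝ E := Ad_one E

variable [LieGroup 𝓘(ℝ, E) ∞ G]

theorem AdE_mul (g k : G) : AdE E (g * k) = (AdE E g).comp (AdE E k) := Ad_mul E g k

theorem AdE_inv_AdE (g : G) (v : E) : AdE E g⁻¹ (AdE E g v) = v := by
  rw [← ContinuousLinearMap.comp_apply, ← AdE_mul, inv_mul_cancel, AdE_one]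
  rfl

theorem AdE_AdE_inv (g : G) (v : E) : AdE E g (AdE E g⁻¹ v) = v := by
  simpa only [inv_inv] using AdE_inv_AdE g⁻¹ v

omit [LieGroup 𝓘(ℝ, E) ∞ G] [Group G] in
theorem mfderiv_comp_apply_of_apply_eq {F H M F' H' N F'' H'' P : Type*}
    [NormedAddCommGroup F] [NormedSpace ℝ F] [TopologicalSpace H] {I : ModelWithCorners ℝ F H}
    [TopologicalSpace M] [ChartedSpace H M]
    [NormedAddCommGroup F'] [NormedSpace ℝ F'] [TopologicalSpace H'] {J : ModelWithCorners ℝ F' H'}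
    [TopologicalSpace N] [ChartedSpace H' N]
    [NormedAddCommGroup F''] [NormedSpace ℝ F''] [TopologicalSpace H'']
    {K : ModelWithCorners ℝ F'' H''} [TopologicalSpace P] [ChartedSpace H'' P]
    {g : N → P} {f : M → N} {x : M} {y : N} (hg : MDifferentiableAt J K g y)
    (hf : MDifferentiableAt I J f x) (hy : f x = y) (v : F) :
    @Eq F'' (mfderiv I K (g ∘ f) x v) (mfderiv J K g y (show F' from mfderiv I J f x v)) := by
  subst hy
  exact mfderiv_comp_apply x hg hf v

omit [LieGroup 𝓘(ℝ, E) ∞ G] [Group G] in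
theorem coordChange_achart_self {F H M : Type*} [NormedAddCommGroup F] [NormedSpace ℝ F]
    [TopologicalSpace H] {I : ModelWithCorners ℝ F H} [TopologicalSpace M] [ChartedSpace H M]
    [IsManifold I 1 M] {i j : atlas H M} {x : M} (hij : i = j) (hi : x ∈ i.1.source) (v : F) :
    (tangentBundleCore I M).coordChange i j x v = v := by
  subst hij
  exact (tangentBundleCore I M).coordChange_self i x hi v

/-- No change of coordinates enters, since the values `f x (g x) = 1` all have the chart at `1` as
preferred chart. -/
theorem contMDiffAt_mfderiv_of_eq_one {F H M F' H' N : Type*}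
    [NormedAddCommGroup F] [NormedSpace ℝ F] [TopologicalSpace H] {I : ModelWithCorners ℝ F H}
    [TopologicalSpace M] [ChartedSpace H M] [IsManifold I ∞ M]
    [NormedAddCommGroup F'] [NormedSpace ℝ F'] [TopologicalSpace H']
    {J : ModelWithCorners ℝ F' H'} [TopologicalSpace N] [ChartedSpace H' N] [IsManifold J ∞ N]
    {f : N → M → G} {g : N → M} {x₀ : N}
    (hf : ContMDiffAt (J.prod I) 𝓘(ℝ, E) ∞ (Function.uncurry f) (x₀, g x₀))
    (hg : ContMDiffAt J I ∞ g x₀) (hfg : ∀ x, f x (g x) = 1)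
    (hc : ∀ x, achart H (g x) = achart H (g x₀)) :
    ContMDiffAt J 𝓘(ℝ, F →L[ℝ] E) ∞
      (fun x => show F →L[ℝ] E from mfderiv I 𝓘(ℝ, E) (f x) (g x)) x₀ := by
  have : IsManifold I 1 M := IsManifold.of_le (n := ∞) (by simp)
  have : IsManifold J 1 N := IsManifold.of_le (n := ∞) (by simp)
  have : IsManifold 𝓘(ℝ, E) 1 G := IsManifold.of_le (n := ∞) (by simp)
  have h := ContMDiffAt.mfderiv (m := ∞) (n := ∞) f g hf hg (by simp)
  refine h.congr_of_eventuallyEq (Filter.Eventually.of_forall fun x => ?_)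
  have hx : g x ∈ (chartAt H (g x₀)).source := by
    have hchart : chartAt H (g x) = chartAt H (g x₀) := congrArg Subtype.val (hc x)
    exact hchart ▸ mem_chart_source H (g x)
  have hy : f x (g x) ∈ (chartAt E (f x₀ (g x₀))).source := by
    rw [hfg, hfg]
    exact mem_chart_source E 1
  refine Eq.trans ?_ (inTangentCoordinates_eq (I := I) (I' := 𝓘(ℝ, E)) g (fun x => f x (g x))
    (fun x => mfderiv I 𝓘(ℝ, E) (f x) (g x)) hx hy).symm
  refine ContinuousLinearMap.ext fun v => Eq.symm ?_
  refine (coordChange_achart_self ?_ ?_ _).trans (congrArg _ (coordChange_achart_self ?_ ?_ _))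
  · rw [hfg, hfg]
  · exact mem_chart_source _ _
  · exact (hc x).symm
  · exact hx

theorem contMDiff_AdE : ContMDiff 𝓘(ℝ, E) 𝓘(ℝ, E →L[ℝ] E) ∞ (AdE E : G → E →L[ℝ] E) := by
  intro g₀
  have : IsManifold 𝓘(ℝ, E) ∞ G := inferInstance
  refine contMDiffAt_mfderiv_of_eq_one (f := fun (g : G) (z : G) => g * z * g⁻¹)
    (g := fun _ => (1 : G)) ?_ contMDiffAt_const (fun _ => by simp) (fun _ => rfl)
  exact ((contMDiff_fst.mul contMDiff_snd).mul contMDiff_fst.inv).contMDiffAt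

theorem mdifferentiableAt_AdE (g : G) :
    MDifferentiableAt 𝓘(ℝ, E) 𝓘(ℝ, E →L[ℝ] E) (AdE E : G → E →L[ℝ] E) g :=
  contMDiff_AdE.mdifferentiable (by simp) g

theorem contDiff_logDeriv_fst {ψ : ℝ → ℝ → G} (hψ : SmoothGroup E ψ) :
    ContDiff ℝ ∞ (fun p : ℝ × ℝ => logDeriv E (fun s => ψ s p.2) p.1) := by
  rw [← contMDiff_iff_contDiff]
  intro p₀
  have h := contMDiffAt_mfderiv_of_eq_one (E := E) (I := 𝓘(ℝ, ℝ)) (J := 𝓘(ℝ, ℝ × ℝ))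
    (f := fun (p : ℝ × ℝ) (s : ℝ) => (ψ p.1 p.2)⁻¹ * ψ s p.2)
    (g := fun p : ℝ × ℝ => p.1) (x₀ := p₀) ?_ (contDiff_fst.contMDiff.contMDiffAt)
    (fun x => by simp) (fun x => rfl)
  · exact h.clm_apply contMDiffAt_const
  · have hswap : ContMDiff (𝓘(ℝ, ℝ × ℝ).prod 𝓘(ℝ, ℝ)) 𝓘(ℝ, ℝ × ℝ) ∞
        (fun q : (ℝ × ℝ) × ℝ => (q.2, q.1.2)) :=
      contMDiff_snd.prodMk_space (contDiff_snd.contMDiff.comp contMDiff_fst)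
    exact ((hψ.comp contMDiff_fst).inv.mul (hψ.comp hswap)).contMDiffAt

theorem contDiff_logDeriv_snd {ψ : ℝ → ℝ → G} (hψ : SmoothGroup E ψ) :
    ContDiff ℝ ∞ (fun p : ℝ × ℝ => logDeriv E (fun s => ψ p.1 s) p.2) :=
  (contDiff_logDeriv_fst hψ.swap).comp (contDiff_snd.prodMk contDiff_fst)

theorem mdifferentiableAt_const_mul {f : ℝ → G} {x : ℝ}
    (hf : MDifferentiableAt 𝓘(ℝ, ℝ) 𝓘(ℝ, E) f x) (g : G) :
    MDifferentiableAt 𝓘(ℝ, ℝ) 𝓘(ℝ, E) (fun s => g * f s) x :=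
  (contMDiff_mul_left (n := ∞)).mdifferentiable (by simp) (f x) |>.comp x hf

theorem mdifferentiableAt_mul_curve {f k : ℝ → G} {x : ℝ}
    (hf : MDifferentiableAt 𝓘(ℝ, ℝ) 𝓘(ℝ, E) f x) (hk : MDifferentiableAt 𝓘(ℝ, ℝ) 𝓘(ℝ, E) k x) :
    MDifferentiableAt 𝓘(ℝ, ℝ) 𝓘(ℝ, E) (fun s => f s * k s) x :=
  MDifferentiableAt.comp (I' := 𝓘(ℝ, E).prod 𝓘(ℝ, E)) (f := fun s => (f s, k s)) x
    ((contMDiff_mul 𝓘(ℝ, E) ∞).mdifferentiable (by simp) _) (hf.prodMk hk)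

theorem mdifferentiableAt_inv_curve {f : ℝ → G} {x : ℝ}
    (hf : MDifferentiableAt 𝓘(ℝ, ℝ) 𝓘(ℝ, E) f x) :
    MDifferentiableAt 𝓘(ℝ, ℝ) 𝓘(ℝ, E) (fun s => (f s)⁻¹) x :=
  ((contMDiff_inv 𝓘(ℝ, E) ∞).mdifferentiable (by simp) _).comp x hf

theorem velocity_mul_of_eq_one {a b : ℝ → G} {x : ℝ}
    (ha : MDifferentiableAt 𝓘(ℝ, ℝ) 𝓘(ℝ, E) a x) (hb : MDifferentiableAt 𝓘(ℝ, ℝ) 𝓘(ℝ, E) b x)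
    (ha1 : a x = 1) (hb1 : b x = 1) :
    velocity E (fun s => a s * b s) x = velocity E a x + velocity E b x := by
  have hm : MDifferentiableAt (𝓘(ℝ, E).prod 𝓘(ℝ, E)) 𝓘(ℝ, E) (fun p : G × G => p.1 * p.2)
      (1, 1) := (contMDiff_mul 𝓘(ℝ, E) ∞).mdifferentiable (by simp) _
  refine (mfderiv_comp_apply_of_apply_eq (f := fun s => (a s, b s)) hm (ha.prodMk hb)
    (by rw [ha1, hb1]) (1 : ℝ)).trans ?_
  refine (mfderiv_prod_eq_add_apply hm).trans ?_
  have hid : ∀ F : G → G, F = id → ∀ v : E, @Eq E (mfderiv 𝓘(ℝ, E) 𝓘(ℝ, E) F 1 v) v := by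
    rintro _ rfl v
    exact DFunLike.congr_fun mfderiv_id v
  rw [ha.mfderiv_prod hb]
  exact congrArg₂ (· + ·) (hid _ (funext mul_one) _) (hid _ (funext one_mul) _)

theorem velocity_conj_of_eq_one {a : ℝ → G} {x : ℝ}
    (ha : MDifferentiableAt 𝓘(ℝ, ℝ) 𝓘(ℝ, E) a x) (ha1 : a x = 1) (g : G) :
    velocity E (fun s => g * a s * g⁻¹) x = AdE E g (velocity E a x) :=
  mfderiv_comp_apply_of_apply_eq (mdifferentiable_conj E g 1) ha ha1 (1 : ℝ)

theorem logDeriv_mul {f k : ℝ → G} {x : ℝ}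
    (hf : MDifferentiableAt 𝓘(ℝ, ℝ) 𝓘(ℝ, E) f x) (hk : MDifferentiableAt 𝓘(ℝ, ℝ) 𝓘(ℝ, E) k x) :
    logDeriv E (fun s => f s * k s) x = AdE E (k x)⁻¹ (logDeriv E f x) + logDeriv E k x := by
  have ha := mdifferentiableAt_const_mul hf (f x)⁻¹
  have hconj : MDifferentiableAt 𝓘(ℝ, ℝ) 𝓘(ℝ, E)
      (fun s => (k x)⁻¹ * ((f x)⁻¹ * f s) * (k x)⁻¹⁻¹) x :=
    MDifferentiableAt.comp x (mdifferentiable_conj E (k x)⁻¹ _) ha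
  have hsplit : (fun s => (f x * k x)⁻¹ * (f s * k s)) = fun s =>
      ((k x)⁻¹ * ((f x)⁻¹ * f s) * (k x)⁻¹⁻¹) * ((k x)⁻¹ * k s) := by
    ext1 s
    group
  rw [logDeriv, hsplit, velocity_mul_of_eq_one hconj (mdifferentiableAt_const_mul hk _)
    (by simp) (by simp), velocity_conj_of_eq_one ha (by simp), logDeriv, logDeriv]

theorem logDeriv_inv {f : ℝ → G} {x : ℝ} (hf : MDifferentiableAt 𝓘(ℝ, ℝ) 𝓘(ℝ, E) f x) :
    logDeriv E (fun s => (f s)⁻¹) x = -AdE E (f x) (logDeriv E f x) := by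
  have h := logDeriv_mul hf (mdifferentiableAt_inv_curve hf)
  have hconst : logDeriv E (fun _ : ℝ => (1 : G)) x = 0 := DFunLike.congr_fun mfderiv_const (1 : ℝ)
  simp only [mul_inv_cancel, inv_inv, hconst] at h
  exact (neg_eq_of_add_eq_zero_right h.symm).symm

end

section

variable {E : Type*} [NormedAddCommGroup E] [NormedSpace ℝ E]
  {G : Type*} [TopologicalSpace G] [ChartedSpace E G] [Group G]
  {W : Type*} [NormedAddCommGroup W] [NormedSpace ℝ W]

theorem hasDerivAt_comp_of_eq_one {Φ : G → W} {a : ℝ → G} {x : ℝ}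
    (hΦ : MDifferentiableAt 𝓘(ℝ, E) 𝓘(ℝ, W) Φ 1)
    (ha : MDifferentiableAt 𝓘(ℝ, ℝ) 𝓘(ℝ, E) a x) (ha1 : a x = 1) :
    HasDerivAt (fun s => Φ (a s)) (mfderivOne (E := E) Φ (velocity E a x)) x := by
  have hΦ' : MDifferentiableAt 𝓘(ℝ, E) 𝓘(ℝ, W) Φ (a x) := by rwa [ha1]
  have hdiff : DifferentiableAt ℝ (fun s => Φ (a s)) x :=
    mdifferentiableAt_iff_differentiableAt.1 (hΦ'.comp x ha)
  have hderiv : @Eq W (deriv (fun s => Φ (a s)) x) (mfderivOne (E := E) Φ (velocity E a x)) := by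
    rw [← fderiv_apply_one_eq_deriv, ← mfderiv_eq_fderiv]
    exact mfderiv_comp_apply_of_apply_eq hΦ ha ha1 (1 : ℝ)
  exact hderiv ▸ hdiff.hasDerivAt

variable [LieGroup 𝓘(ℝ, E) ∞ G]

theorem hasDerivAt_AdE {f : ℝ → G} {x : ℝ} (hf : MDifferentiableAt 𝓘(ℝ, ℝ) 𝓘(ℝ, E) f x) :
    HasDerivAt (fun s => AdE E (f s)) ((AdE E (f x)).comp (adE E G (logDeriv E f x))) x := by
  have h := hasDerivAt_comp_of_eq_one (mdifferentiableAt_AdE (E := E) (1 : G))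
    (mdifferentiableAt_const_mul hf (f x)⁻¹) (inv_mul_cancel _)
  have hmul : (fun s => AdE E (f s)) = fun s => (AdE E (f x)).comp (AdE E ((f x)⁻¹ * f s)) := by
    ext1 s
    rw [← AdE_mul, mul_inv_cancel_left]
  rw [hmul]
  simpa only [ContinuousLinearMap.zero_comp, zero_add] using!
    (hasDerivAt_const x (AdE E (f x))).clm_comp h

theorem hasDerivAt_AdE_apply {f : ℝ → G} {F : ℝ → E} {x : ℝ} {F' : E}
    (hf : MDifferentiableAt 𝓘(ℝ, ℝ) 𝓘(ℝ, E) f x) (hF : HasDerivAt F F' x) :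
    HasDerivAt (fun s => AdE E (f s) (F s))
      (AdE E (f x) (adE E G (logDeriv E f x) (F x) + F')) x := by
  simpa using (hasDerivAt_AdE hf).clm_apply hF

theorem mfderivOne_comp_conj {Φ : G → W} (hΦ : MDifferentiableAt 𝓘(ℝ, E) 𝓘(ℝ, W) Φ 1) (g : G)
    (v : E) :
    mfderivOne (E := E) (fun z => Φ (g * z * g⁻¹)) v = mfderivOne (E := E) Φ (AdE E g v) :=
  mfderiv_comp_apply_of_apply_eq hΦ (mdifferentiable_conj E g 1) (by simp) v

theorem AdE_adE (g : G) (v w : E) :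
    AdE E g (adE E G v w) = adE E G (AdE E g v) (AdE E g w) := by
  let T : (E →L[ℝ] E) →L[ℝ] (E →L[ℝ] E) :=
    (ContinuousLinearMap.compL ℝ E E E (AdE E g)).comp
      ((ContinuousLinearMap.compL ℝ E E E).flip (AdE E g⁻¹))
  have hAd : (fun z : G => AdE E (g * z * g⁻¹)) = T ∘ AdE E := by
    funext z
    simp [T, AdE_mul, ContinuousLinearMap.comp_assoc]
  have hT : mfderivOne (E := E) (fun z : G => AdE E (g * z * g⁻¹)) v = T (adE E G v) := by
    rw [hAd]
    exact DFunLike.congr_fun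
      (T.hasMFDerivAt.comp (1 : G) (mdifferentiableAt_AdE (E := E) (1 : G)).hasMFDerivAt).mfderiv v
  rw [show adE E G (AdE E g v) = T (adE E G v) from
    (mfderivOne_comp_conj (mdifferentiableAt_AdE 1) g v).symm.trans hT]
  simp [T, AdE_inv_AdE]

end

section

/-! ### The group law in a chart -/

variable {E : Type*} [NormedAddCommGroup E] [NormedSpace ℝ E]
  {G : Type*} [TopologicalSpace G] [ChartedSpace E G] [Group G]

variable (E G) in
/-- The coordinates of `1` in the chart at `1`. -/
def chartOne : E := extChartAt 𝓘(ℝ, E) (1 : G) 1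

variable (E G) in
/-- The product of the group, read in the chart at `1`. -/
def chartMul (p : E × E) : E :=
  extChartAt 𝓘(ℝ, E) (1 : G)
    ((extChartAt 𝓘(ℝ, E) (1 : G)).symm p.1 * (extChartAt 𝓘(ℝ, E) (1 : G)).symm p.2)

variable (E G) in
/-- The derivative at `1` of the left translation by the point with coordinate `u`, in the
chart at `1`. -/
def leftD (u : E) : E →L[ℝ] E := fderiv ℝ (fun w => chartMul E G (u, w)) (chartOne E G)

variable (E G) in
/-- The derivative at `1` of the right translation by the point with coordinate `u`, in the
chart at `1`. -/
def rightD (u : E) : E →L[ℝ] E := fderiv ℝ (fun w => chartMul E G (w, u)) (chartOne E G)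

theorem extChartAt_symm_chartOne : (extChartAt 𝓘(ℝ, E) (1 : G)).symm (chartOne E G) = 1 :=
  extChartAt_to_inv 1

theorem target_mem_nhds_chartOne : (extChartAt 𝓘(ℝ, E) (1 : G)).target ∈ 𝓝 (chartOne E G) :=
  extChartAt_target_mem_nhds 1

theorem chartOne_mem_target : chartOne E G ∈ (extChartAt 𝓘(ℝ, E) (1 : G)).target :=
  mem_of_mem_nhds target_mem_nhds_chartOne

theorem chartMul_one_left {u : E} (hu : u ∈ (extChartAt 𝓘(ℝ, E) (1 : G)).target) :
    chartMul E G (chartOne E G, u) = u := by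
  rw [chartMul, extChartAt_symm_chartOne, one_mul, (extChartAt 𝓘(ℝ, E) (1 : G)).right_inv hu]

theorem chartMul_one_right {u : E} (hu : u ∈ (extChartAt 𝓘(ℝ, E) (1 : G)).target) :
    chartMul E G (u, chartOne E G) = u := by
  rw [chartMul, extChartAt_symm_chartOne, mul_one, (extChartAt 𝓘(ℝ, E) (1 : G)).right_inv hu]

theorem leftD_one : leftD E G (chartOne E G) = ContinuousLinearMap.id ℝ E := by
  have h : (fun w => chartMul E G (chartOne E G, w)) =ᶠ[𝓝 (chartOne E G)] id := by
    filter_upwards [target_mem_nhds_chartOne (E := E) (G := G)] with u hu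
    exact chartMul_one_left hu
  rw [leftD, h.fderiv_eq, fderiv_id]

theorem rightD_one : rightD E G (chartOne E G) = ContinuousLinearMap.id ℝ E := by
  have h : (fun w => chartMul E G (w, chartOne E G)) =ᶠ[𝓝 (chartOne E G)] id := by
    filter_upwards [target_mem_nhds_chartOne (E := E) (G := G)] with u hu
    exact chartMul_one_right hu
  rw [rightD, h.fderiv_eq, fderiv_id]

section Chart

variable {W : Type*} [NormedAddCommGroup W] [NormedSpace ℝ W] {Φ : G → W}

theorem mfderivOne_eq_fderiv (hΦ : MDifferentiableAt 𝓘(ℝ, E) 𝓘(ℝ, W) Φ 1) :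
    mfderivOne (E := E) Φ
      = fderiv ℝ (fun u => Φ ((extChartAt 𝓘(ℝ, E) (1 : G)).symm u)) (chartOne E G) := by
  rw [mfderivOne, hΦ.mfderiv]
  simp only [writtenInExtChartAt, extChartAt_model_space_eq_id, PartialEquiv.refl_coe,
    Function.id_comp, modelWithCornersSelf_coe, Set.range_id, fderivWithin_univ]
  rfl

theorem differentiableAt_of_mdifferentiableAt_one (hΦ : MDifferentiableAt 𝓘(ℝ, E) 𝓘(ℝ, W) Φ 1) :
    DifferentiableAt ℝ (fun u => Φ ((extChartAt 𝓘(ℝ, E) (1 : G)).symm u)) (chartOne E G) := by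
  simpa only [writtenInExtChartAt, extChartAt_model_space_eq_id, PartialEquiv.refl_coe,
    Function.id_comp, modelWithCornersSelf_coe, Set.range_id, differentiableWithinAt_univ] using!
    hΦ.differentiableWithinAt_writtenInExtChartAt

end Chart

variable [LieGroup 𝓘(ℝ, E) ∞ G]

theorem contDiffAt_chartMul_of_mem {u : E} (hu : u ∈ (extChartAt 𝓘(ℝ, E) (1 : G)).target) :
    ContDiffAt ℝ ∞ (chartMul E G) (u, chartOne E G) := by
  have hs : ∀ v ∈ (extChartAt 𝓘(ℝ, E) (1 : G)).target,
      ContMDiffAt 𝓘(ℝ, E) 𝓘(ℝ, E) ∞ (extChartAt 𝓘(ℝ, E) (1 : G)).symm v := fun v hv =>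
    (contMDiffOn_extChartAt_symm (1 : G)).contMDiffAt ((isOpen_extChartAt_target 1).mem_nhds hv)
  have hmul : ContMDiffAt 𝓘(ℝ, E × E) 𝓘(ℝ, E) ∞ (fun p : E × E =>
      (extChartAt 𝓘(ℝ, E) (1 : G)).symm p.1 * (extChartAt 𝓘(ℝ, E) (1 : G)).symm p.2)
      (u, chartOne E G) :=
    (ContMDiffAt.comp (u, chartOne E G) (hs u hu) contDiff_fst.contMDiff.contMDiffAt).mul
      (ContMDiffAt.comp (u, chartOne E G) (hs _ chartOne_mem_target)
        contDiff_snd.contMDiff.contMDiffAt)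
  rw [← contMDiffAt_iff_contDiffAt]
  refine ContMDiffAt.comp (u, chartOne E G) ?_ hmul
  simp only [extChartAt_symm_chartOne, mul_one]
  refine contMDiffAt_extChartAt' ?_
  rw [← extChartAt_source 𝓘(ℝ, E)]
  exact (extChartAt 𝓘(ℝ, E) (1 : G)).map_target hu

theorem contDiffAt_chartMul : ContDiffAt ℝ ∞ (chartMul E G) (chartOne E G, chartOne E G) :=
  contDiffAt_chartMul_of_mem chartOne_mem_target

theorem contDiffAt_leftD_of_mem {u : E} (hu : u ∈ (extChartAt 𝓘(ℝ, E) (1 : G)).target) :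
    ContDiffAt ℝ ∞ (leftD E G) u :=
  ContDiffAt.fderiv (f := fun u w => chartMul E G (u, w)) (contDiffAt_chartMul_of_mem hu)
    contDiffAt_const (by simp)

theorem contDiffAt_leftD : ContDiffAt ℝ ∞ (leftD E G) (chartOne E G) :=
  contDiffAt_leftD_of_mem chartOne_mem_target

theorem contDiffAt_rightD : ContDiffAt ℝ ∞ (rightD E G) (chartOne E G) :=
  ContDiffAt.fderiv (f := fun u w => chartMul E G (w, u))
    (ContDiffAt.comp (f := Prod.swap) (chartOne E G, chartOne E G) contDiffAt_chartMul
      (contDiffAt_snd.prodMk contDiffAt_fst)) contDiffAt_const (n := ∞) (by simp)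

theorem eventually_differentiableAt_chartMul :
    ∀ᶠ p in 𝓝 (chartOne E G, chartOne E G), DifferentiableAt ℝ (chartMul E G) p := by
  have h := (contDiffAt_chartMul (E := E) (G := G)).of_le (m := 1) (by simp)
  filter_upwards [h.eventually (by simp)] with p hp
  exact hp.differentiableAt (by simp)

theorem fderiv_leftD (v w : E) : fderiv ℝ (leftD E G) (chartOne E G) v w =
    fderiv ℝ (fderiv ℝ (chartMul E G)) (chartOne E G, chartOne E G) (v, 0) (0, w) := by
  have hd : DifferentiableAt ℝ (fderiv ℝ (chartMul E G)) (chartOne E G, chartOne E G) :=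
    (contDiffAt_chartMul.fderiv_right (m := 1) (by decide)).differentiableAt (by simp)
  have heq : leftD E G =ᶠ[𝓝 (chartOne E G)] fun u =>
      (fderiv ℝ (chartMul E G) (u, chartOne E G)).comp (ContinuousLinearMap.inr ℝ E E) := by
    have htend := (Continuous.prodMk_left (chartOne E G)).tendsto (chartOne E G)
    filter_upwards [htend.eventually eventually_differentiableAt_chartMul] with u hu
    exact (hu.hasFDerivAt.comp (chartOne E G) (hasFDerivAt_prodMk_right u _)).fderiv
  have hderiv : HasFDerivAt (leftD E G) _ (chartOne E G) :=
    ((HasFDerivAt.comp (f := fun u => (u, chartOne E G)) (chartOne E G) hd.hasFDerivAt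
      (hasFDerivAt_prodMk_left _ _)).clm_comp
        (hasFDerivAt_const (ContinuousLinearMap.inr ℝ E E) _)).congr_of_eventuallyEq heq
  rw [hderiv.fderiv]
  simp

theorem fderiv_rightD (v w : E) : fderiv ℝ (rightD E G) (chartOne E G) v w =
    fderiv ℝ (fderiv ℝ (chartMul E G)) (chartOne E G, chartOne E G) (0, v) (w, 0) := by
  have hd : DifferentiableAt ℝ (fderiv ℝ (chartMul E G)) (chartOne E G, chartOne E G) :=
    (contDiffAt_chartMul.fderiv_right (m := 1) (by decide)).differentiableAt (by simp)
  have heq : rightD E G =ᶠ[𝓝 (chartOne E G)] fun u =>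
      (fderiv ℝ (chartMul E G) (chartOne E G, u)).comp (ContinuousLinearMap.inl ℝ E E) := by
    have htend := (Continuous.prodMk_right (chartOne E G)).tendsto (chartOne E G)
    filter_upwards [htend.eventually eventually_differentiableAt_chartMul] with u hu
    exact (HasFDerivAt.comp (f := fun w => (w, u)) (chartOne E G) hu.hasFDerivAt
      (hasFDerivAt_prodMk_left _ u)).fderiv
  have hderiv : HasFDerivAt (rightD E G) _ (chartOne E G) :=
    ((HasFDerivAt.comp (f := fun u => (chartOne E G, u)) (chartOne E G) hd.hasFDerivAt
      (hasFDerivAt_prodMk_right _ _)).clm_comp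
        (hasFDerivAt_const (ContinuousLinearMap.inl ℝ E E) _)).congr_of_eventuallyEq heq
  rw [hderiv.fderiv]
  simp

theorem fderiv_rightD_eq_fderiv_leftD (v w : E) :
    fderiv ℝ (rightD E G) (chartOne E G) v w = fderiv ℝ (leftD E G) (chartOne E G) w v := by
  have hsymm := (contDiffAt_chartMul (E := E) (G := G)).isSymmSndFDerivAt
    (by rw [minSmoothness_of_isRCLikeNormedField]; exact ENat.LEInfty.out)
  rw [fderiv_rightD, fderiv_leftD, hsymm.eq]

theorem mdifferentiableAt_extChartAt_mul_left {g : G} (hg : g ∈ (chartAt E (1 : G)).source) :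
    MDifferentiableAt 𝓘(ℝ, E) 𝓘(ℝ, E) (fun z => extChartAt 𝓘(ℝ, E) (1 : G) (g * z)) 1 := by
  have : IsManifold 𝓘(ℝ, E) 1 G := IsManifold.of_le (n := ∞) (by simp)
  refine MDifferentiableAt.comp (1 : G) ?_ (contMDiff_mul_left.mdifferentiable (n := ∞) (by simp) 1)
  rw [mul_one]
  exact mdifferentiableAt_extChartAt hg

theorem mdifferentiableAt_extChartAt_mul_right {g : G} (hg : g ∈ (chartAt E (1 : G)).source) :
    MDifferentiableAt 𝓘(ℝ, E) 𝓘(ℝ, E) (fun z => extChartAt 𝓘(ℝ, E) (1 : G) (z * g)) 1 := by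
  have : IsManifold 𝓘(ℝ, E) 1 G := IsManifold.of_le (n := ∞) (by simp)
  refine MDifferentiableAt.comp (1 : G) ?_
    (contMDiff_mul_right.mdifferentiable (n := ∞) (by simp) 1)
  rw [one_mul]
  exact mdifferentiableAt_extChartAt hg

theorem leftD_extChartAt {g : G} (hg : g ∈ (chartAt E (1 : G)).source) :
    leftD E G (extChartAt 𝓘(ℝ, E) (1 : G) g)
      = mfderivOne (fun z => extChartAt 𝓘(ℝ, E) (1 : G) (g * z)) := by
  rw [mfderivOne_eq_fderiv (mdifferentiableAt_extChartAt_mul_left hg), leftD]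
  simp only [chartMul, (extChartAt 𝓘(ℝ, E) (1 : G)).left_inv (by rwa [extChartAt_source])]

theorem rightD_extChartAt {g : G} (hg : g ∈ (chartAt E (1 : G)).source) :
    rightD E G (extChartAt 𝓘(ℝ, E) (1 : G) g)
      = mfderivOne (fun z => extChartAt 𝓘(ℝ, E) (1 : G) (z * g)) := by
  rw [mfderivOne_eq_fderiv (mdifferentiableAt_extChartAt_mul_right hg), rightD]
  simp only [chartMul, (extChartAt 𝓘(ℝ, E) (1 : G)).left_inv (by rwa [extChartAt_source])]

theorem rightD_AdE {g : G} (hg : g ∈ (chartAt E (1 : G)).source) (w : E) :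
    rightD E G (extChartAt 𝓘(ℝ, E) (1 : G) g) (AdE E g w)
      = leftD E G (extChartAt 𝓘(ℝ, E) (1 : G) g) w := by
  rw [rightD_extChartAt hg, leftD_extChartAt hg,
    ← mfderivOne_comp_conj (mdifferentiableAt_extChartAt_mul_right hg)]
  simp only [inv_mul_cancel_right]

theorem adE_eq_fderiv_leftD (v w : E) :
    adE E G v w = fderiv ℝ (leftD E G) (chartOne E G) v w
      - fderiv ℝ (leftD E G) (chartOne E G) w v := by
  have hAd : MDifferentiableAt 𝓘(ℝ, E) 𝓘(ℝ, E →L[ℝ] E) (AdE E : G → E →L[ℝ] E) 1 :=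
    mdifferentiableAt_AdE 1
  have hright : DifferentiableAt ℝ (rightD E G) (chartOne E G) :=
    contDiffAt_rightD.differentiableAt (by simp)
  have hleft : (fun u => (rightD E G u).comp (AdE E ((extChartAt 𝓘(ℝ, E) (1 : G)).symm u)))
      =ᶠ[𝓝 (chartOne E G)] leftD E G := by
    filter_upwards [target_mem_nhds_chartOne (E := E) (G := G)] with u hu
    have hs := (extChartAt 𝓘(ℝ, E) (1 : G)).map_target hu
    rw [extChartAt_source] at hs
    ext w
    simpa only [ContinuousLinearMap.comp_apply, (extChartAt 𝓘(ℝ, E) (1 : G)).right_inv hu]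
      using rightD_AdE hs w
  have hderiv := (hright.hasFDerivAt.clm_comp
    (differentiableAt_of_mdifferentiableAt_one hAd).hasFDerivAt).fderiv
  rw [hleft.fderiv_eq, ← mfderivOne_eq_fderiv hAd] at hderiv
  have happly := congrArg (fun L : E →L[ℝ] E →L[ℝ] E => L v w) hderiv
  simp only [rightD_one, extChartAt_symm_chartOne, AdE_one] at happly
  rw [eq_sub_iff_add_eq, happly, ← fderiv_rightD_eq_fderiv_leftD]
  rfl

end

section

/-! ### The Maurer–Cartan equation -/

variable {E : Type*} [NormedAddCommGroup E] [NormedSpace ℝ E]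
  {G : Type*} [TopologicalSpace G] [ChartedSpace E G] [Group G] [LieGroup 𝓘(ℝ, E) ∞ G]

theorem mfderivOne_extChartAt :
    mfderivOne (extChartAt 𝓘(ℝ, E) (1 : G)) = ContinuousLinearMap.id ℝ E := by
  have h := leftD_extChartAt (E := E) (mem_chart_source E (1 : G))
  simp only [one_mul] at h
  exact h.symm.trans leftD_one

theorem mpullbackWithin_mulInvariantVectorField {u : E}
    (hu : u ∈ (extChartAt 𝓘(ℝ, E) (1 : G)).target) (v : E) :
    @Eq E (VectorField.mpullbackWithin 𝓘(ℝ, E) 𝓘(ℝ, E) (extChartAt 𝓘(ℝ, E) (1 : G)).symm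
      (mulInvariantVectorField (I := 𝓘(ℝ, E)) (G := G) v) (Set.range 𝓘(ℝ, E)) u)
      (leftD E G u v) := by
  have : IsManifold 𝓘(ℝ, E) 1 G := IsManifold.of_le (n := ∞) (by simp)
  have hg := (extChartAt 𝓘(ℝ, E) (1 : G)).map_target hu
  rw [extChartAt_source] at hg
  have hinv := ContinuousLinearMap.inverse_eq
    (mfderivWithin_extChartAt_symm_comp_mfderiv_extChartAt hu)
    (mfderiv_extChartAt_comp_mfderivWithin_extChartAt_symm hu)
  refine (DFunLike.congr_fun hinv _).trans (Eq.symm ?_)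
  conv_lhs => rw [← (extChartAt 𝓘(ℝ, E) (1 : G)).right_inv hu, leftD_extChartAt hg]
  exact mfderiv_comp_apply_of_apply_eq (mdifferentiableAt_extChartAt hg)
    ((contMDiff_mul_left (n := ∞)).mdifferentiable (by simp) (1 : G)) (mul_one _) v

theorem fderiv_leftD_apply (v w : E) : fderiv ℝ (fun u => leftD E G u v) (chartOne E G) w =
    fderiv ℝ (leftD E G) (chartOne E G) w v := by
  have hd : DifferentiableAt ℝ (leftD E G) (chartOne E G) :=
    contDiffAt_leftD.differentiableAt (by simp)
  rw [(hd.hasFDerivAt.clm_apply (hasFDerivAt_const v _)).fderiv]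
  simp

theorem lieBracket_leftD (v w : E) :
    VectorField.lieBracket ℝ (fun u => leftD E G u v) (fun u => leftD E G u w) (chartOne E G) =
      fderiv ℝ (leftD E G) (chartOne E G) v w - fderiv ℝ (leftD E G) (chartOne E G) w v := by
  simp only [VectorField.lieBracket_eq, leftD_one, ContinuousLinearMap.id_apply,
    fderiv_leftD_apply]

theorem lie_eq_fderiv_leftD (v w : GroupLieAlgebra 𝓘(ℝ, E) G) :
    @Eq E (⁅v, w⁆ : GroupLieAlgebra 𝓘(ℝ, E) G)
      (fderiv ℝ (leftD E G) (chartOne E G) v w - fderiv ℝ (leftD E G) (chartOne E G) w v) := by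
  have : IsManifold 𝓘(ℝ, E) 1 G := IsManifold.of_le (n := ∞) (by simp)
  have hX : ∀ a : E, VectorField.mpullbackWithin 𝓘(ℝ, E) 𝓘(ℝ, E)
      (extChartAt 𝓘(ℝ, E) (1 : G)).symm (mulInvariantVectorField (I := 𝓘(ℝ, E)) (G := G) a)
      (Set.range 𝓘(ℝ, E)) =ᶠ[𝓝 (chartOne E G)] (fun u => leftD E G u a : E → E) := fun a => by
    filter_upwards [target_mem_nhds_chartOne (E := E) (G := G)] with u hu
    exact mpullbackWithin_mulInvariantVectorField hu a
  have hlie : ∀ (X Y : E → E) (s : Set E), s = Set.univ →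
      X =ᶠ[𝓝 (chartOne E G)] (fun u => leftD E G u v : E → E) →
      Y =ᶠ[𝓝 (chartOne E G)] (fun u => leftD E G u w : E → E) →
      VectorField.lieBracketWithin ℝ X Y s (chartOne E G) =
        fderiv ℝ (leftD E G) (chartOne E G) v w - fderiv ℝ (leftD E G) (chartOne E G) w v := by
    rintro X Y s rfl hXv hYw
    rw [VectorField.lieBracketWithin_univ, hXv.lieBracket_vectorField_eq hYw]
    exact lieBracket_leftD (E := E) (G := G) v w
  have hid : ∀ z : E,
      @Eq E ((mfderiv 𝓘(ℝ, E) 𝓘(ℝ, E) (extChartAt 𝓘(ℝ, E) (1 : G)) 1).inverse z) z := fun z =>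
    (isInvertible_mfderiv_extChartAt (mem_extChartAt_source 1)).inverse_apply_eq.2
      (DFunLike.congr_fun (mfderivOne_extChartAt (E := E) (G := G)) z).symm
  exact (hid _).trans (hlie _ _ _ (by simp) (hX v) (hX w))

theorem adE_apply (v w : GroupLieAlgebra 𝓘(ℝ, E) G) :
    @Eq E (adE E G v w) (⁅v, w⁆ : GroupLieAlgebra 𝓘(ℝ, E) G) :=
  (adE_eq_fderiv_leftD (E := E) (G := G) v w).trans (lie_eq_fderiv_leftD v w).symm

theorem hasDerivAt_extChartAt_comp {f : ℝ → G} {x : ℝ}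
    (hf : MDifferentiableAt 𝓘(ℝ, ℝ) 𝓘(ℝ, E) f x) (hfx : f x ∈ (chartAt E (1 : G)).source) :
    HasDerivAt (fun s => extChartAt 𝓘(ℝ, E) (1 : G) (f s))
      (leftD E G (extChartAt 𝓘(ℝ, E) (1 : G) (f x)) (logDeriv E f x)) x := by
  have h := hasDerivAt_comp_of_eq_one (mdifferentiableAt_extChartAt_mul_left hfx)
    (mdifferentiableAt_const_mul hf (f x)⁻¹) (inv_mul_cancel _)
  simpa only [mul_inv_cancel_left, leftD_extChartAt hfx] using! h

theorem hasDerivAt_leftD_apply {u B : ℝ → E} {u' B' : E} {x : ℝ} (hu : HasDerivAt u u' x)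
    (hB : HasDerivAt B B' x) (hux : u x = chartOne E G) :
    HasDerivAt (fun s => leftD E G (u s) (B s))
      (fderiv ℝ (leftD E G) (chartOne E G) u' (B x) + B') x := by
  have hd : HasFDerivAt (leftD E G) (fderiv ℝ (leftD E G) (chartOne E G)) (u x) := by
    rw [hux]
    exact (contDiffAt_leftD.differentiableAt (by simp)).hasFDerivAt
  simpa only [Function.comp_apply, hux, leftD_one, ContinuousLinearMap.id_apply] using!
    (hd.comp_hasDerivAt x hu).clm_apply hB

end

section

variable {W : Type*} [NormedAddCommGroup W] [NormedSpace ℝ W] {F : ℝ × ℝ → W} {x t : ℝ}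

theorem hasDerivAt_comp_prodMk_fst (hF : DifferentiableAt ℝ F (x, t)) :
    HasDerivAt (fun s => F (s, t)) (fderiv ℝ F (x, t) (1, 0)) x :=
  HasFDerivAt.comp_hasDerivAt (f := fun s => (s, t)) x hF.hasFDerivAt
    ((hasDerivAt_id x).prodMk (hasDerivAt_const x t))

theorem hasDerivAt_comp_prodMk_snd (hF : DifferentiableAt ℝ F (x, t)) :
    HasDerivAt (fun s => F (x, s)) (fderiv ℝ F (x, t) (0, 1)) t :=
  HasFDerivAt.comp_hasDerivAt (f := fun s => (x, s)) t hF.hasFDerivAt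
    ((hasDerivAt_const t x).prodMk (hasDerivAt_id t))

theorem deriv_deriv_comm (hF : ContDiffAt ℝ 2 F (x, t)) :
    deriv (fun s => deriv (fun r => F (s, r)) t) x =
      deriv (fun r => deriv (fun s => F (s, r)) x) t := by
  have hdiff : ∀ᶠ p in 𝓝 (x, t), DifferentiableAt ℝ F p :=
    (hF.eventually (by simp)).mono fun p hp => hp.differentiableAt (by simp)
  have hF' : DifferentiableAt ℝ (fderiv ℝ F) (x, t) :=
    (hF.fderiv_right (m := 1) (by norm_num)).differentiableAt (by simp)
  have hfst : (fun s => deriv (fun r => F (s, r)) t) =ᶠ[𝓝 x] fun s => fderiv ℝ F (s, t) (0, 1) := by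
    filter_upwards [((Continuous.prodMk_left t).tendsto x).eventually hdiff] with s hs
    exact (hasDerivAt_comp_prodMk_snd hs).deriv
  have hsnd : (fun r => deriv (fun s => F (s, r)) x) =ᶠ[𝓝 t] fun r => fderiv ℝ F (x, r) (1, 0) := by
    filter_upwards [((Continuous.prodMk_right x).tendsto t).eventually hdiff] with r hr
    exact (hasDerivAt_comp_prodMk_fst hr).deriv
  have hsymm : IsSymmSndFDerivAt ℝ F (x, t) :=
    hF.isSymmSndFDerivAt (by rw [minSmoothness_of_isRCLikeNormedField])
  rw [hfst.deriv_eq, hsnd.deriv_eq,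
    ((hasDerivAt_comp_prodMk_fst hF').clm_apply (hasDerivAt_const x _)).deriv,
    ((hasDerivAt_comp_prodMk_snd hF').clm_apply (hasDerivAt_const t _)).deriv]
  simpa using hsymm.eq (1, 0) (0, 1)

theorem hasDerivAt_fst (hF : ContDiff ℝ ∞ F) (x t : ℝ) :
    HasDerivAt (fun s => F (s, t)) (deriv (fun s => F (s, t)) x) x :=
  (hasDerivAt_comp_prodMk_fst (hF.differentiable (by simp) _)).differentiableAt.hasDerivAt

theorem hasDerivAt_snd (hF : ContDiff ℝ ∞ F) (x t : ℝ) :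
    HasDerivAt (fun s => F (x, s)) (deriv (fun s => F (x, s)) t) t :=
  (hasDerivAt_comp_prodMk_snd (hF.differentiable (by simp) _)).differentiableAt.hasDerivAt

end

section

variable {E : Type*} [NormedAddCommGroup E] [NormedSpace ℝ E]
  {G : Type*} [TopologicalSpace G] [ChartedSpace E G]

theorem SmoothGroup.mdifferentiable_fst {ψ : ℝ → ℝ → G} (hψ : SmoothGroup E ψ) (t : ℝ) :
    MDifferentiable 𝓘(ℝ, ℝ) 𝓘(ℝ, E) (fun s => ψ s t) :=
  (hψ.comp (contDiff_id.prodMk contDiff_const).contMDiff).mdifferentiable (by simp)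

variable [Group G] [LieGroup 𝓘(ℝ, E) ∞ G] {ψ : ℝ → ℝ → G}

/-- The two mixed derivatives of `u = extChartAt 1 ∘ ψ` are those of `leftD(u) (ψ⁻¹ ψ_t)` and
`leftD(u) (ψ⁻¹ ψ_x)`. -/
theorem maurerCartan_of_eq_one (hψ : SmoothGroup E ψ) {x t : ℝ} (hone : ψ x t = 1) :
    deriv (fun s => logDeriv E (fun r => ψ s r) t) x
      - deriv (fun s => logDeriv E (fun r => ψ r s) x) t
      + adE E G (logDeriv E (fun s => ψ s t) x) (logDeriv E (fun s => ψ x s) t) = 0 := by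
  have hsrc : ∀ᶠ p : ℝ × ℝ in 𝓝 (x, t), ψ p.1 p.2 ∈ (chartAt E (1 : G)).source := by
    rw [← hone]
    exact hψ.continuous.continuousAt.eventually_mem (chart_source_mem_nhds E (ψ x t))
  let u : ℝ × ℝ → E := fun p => extChartAt 𝓘(ℝ, E) (1 : G) (ψ p.1 p.2)
  have hu : ContDiffAt ℝ 2 u (x, t) := by
    refine contMDiffAt_iff_contDiffAt.1
      (ContMDiffAt.comp (x, t) ?_ (hψ.of_le ENat.LEInfty.out (x, t)))
    have : IsManifold 𝓘(ℝ, E) 2 G := IsManifold.of_le (n := ∞) ENat.LEInfty.out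
    exact contMDiffAt_extChartAt' hsrc.self_of_nhds
  have hux : u (x, t) = chartOne E G := congrArg (extChartAt 𝓘(ℝ, E) (1 : G)) hone
  have dx : ∀ s r, ψ s r ∈ (chartAt E (1 : G)).source → HasDerivAt (fun s => u (s, r))
      (leftD E G (u (s, r)) (logDeriv E (fun s => ψ s r) s)) s := fun s r =>
    hasDerivAt_extChartAt_comp (hψ.mdifferentiable_fst r s)
  have dt : ∀ s r, ψ s r ∈ (chartAt E (1 : G)).source → HasDerivAt (fun r => u (s, r))
      (leftD E G (u (s, r)) (logDeriv E (fun r => ψ s r) r)) r := fun s r =>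
    hasDerivAt_extChartAt_comp (hψ.swap.mdifferentiable_fst s r)
  have hxt : (fun s => deriv (fun r => u (s, r)) t) =ᶠ[𝓝 x]
      fun s => leftD E G (u (s, t)) (logDeriv E (fun r => ψ s r) t) := by
    filter_upwards [((Continuous.prodMk_left t).tendsto x).eventually hsrc] with s hs
    exact (dt s t hs).deriv
  have htx : (fun r => deriv (fun s => u (s, r)) x) =ᶠ[𝓝 t]
      fun r => leftD E G (u (x, r)) (logDeriv E (fun s => ψ s r) x) := by
    filter_upwards [((Continuous.prodMk_right x).tendsto t).eventually hsrc] with r hr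
    exact (dx x r hr).deriv
  have hcomm := deriv_deriv_comm hu
  rw [hxt.deriv_eq, htx.deriv_eq,
    (hasDerivAt_leftD_apply (dx x t hsrc.self_of_nhds)
      (hasDerivAt_fst (contDiff_logDeriv_snd hψ) x t) hux).deriv,
    (hasDerivAt_leftD_apply (dt x t hsrc.self_of_nhds)
      (hasDerivAt_snd (contDiff_logDeriv_fst hψ) x t) hux).deriv, hux, leftD_one] at hcomm
  rw [adE_eq_fderiv_leftD, ← sub_eq_zero.2 hcomm]
  simp only [ContinuousLinearMap.id_apply]
  abel

theorem maurerCartan (hψ : SmoothGroup E ψ) (x t : ℝ) :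
    deriv (fun s => logDeriv E (fun r => ψ s r) t) x
      - deriv (fun s => logDeriv E (fun r => ψ r s) x) t
      + adE E G (logDeriv E (fun s => ψ s t) x) (logDeriv E (fun s => ψ x s) t) = 0 := by
  have hleft : SmoothGroup E fun s r => (ψ x t)⁻¹ * ψ s r :=
    (contMDiff_mul_left (n := ∞)).comp hψ
  simpa only [logDeriv_const_mul] using maurerCartan_of_eq_one hleft (inv_mul_cancel (ψ x t))

end

section

/-! ### Smooth dependence of flows on the initial value -/

universe u v w

variable (K : Type u) [TopologicalSpace K] [CompactSpace K]

/-- Pointwise application of a continuous family of operators to a continuous function, as a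
continuous bilinear map; superposition operators have derivatives of this form. -/
def pointwiseApply (X Y : Type*) [NormedAddCommGroup X] [NormedSpace ℝ X] [NormedAddCommGroup Y]
    [NormedSpace ℝ Y] : C(K, X →L[ℝ] Y) →L[ℝ] C(K, X) →L[ℝ] C(K, Y) :=
  LinearMap.mkContinuous₂ (E := C(K, X →L[ℝ] Y)) (F := C(K, X)) (G := C(K, Y))
    (LinearMap.mk₂ ℝ (fun A u => ⟨fun s => A s (u s), A.continuous.clm_apply u.continuous⟩)
      (fun A B u => by ext s; simp)
      (fun c A u => by ext s; simp)
      (fun A u v => by ext s; simp)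
      (fun c A u => by ext s; simp)) 1 fun A u => by
    rw [one_mul]
    exact (ContinuousMap.norm_le _ (by positivity)).2 fun s =>
      (A s).le_of_opNorm_le_of_le (A.norm_coe_le_norm s) (u.norm_coe_le_norm s)

variable {K}

@[simp]
theorem pointwiseApply_apply {X Y : Type*} [NormedAddCommGroup X] [NormedSpace ℝ X]
    [NormedAddCommGroup Y] [NormedSpace ℝ Y] (A : C(K, X →L[ℝ] Y)) (u : C(K, X)) (s : K) :
    pointwiseApply K X Y A u s = A s (u s) := rfl

theorem norm_sub_le_of_dist_postcomp_lt {X Y : Type*} [NormedAddCommGroup X]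
    [NormedAddCommGroup Y] {f : C(X, Y)} {u : C(K, X)} {ε δ : ℝ} (hδ : 0 < δ)
    (hf : ∀ ⦃v : C(K, X)⦄, dist v u < δ → dist (f.comp v) (f.comp u) < ε) (s : K) {y : X}
    (hy : y ∈ Metric.ball (u s) δ) : ‖f y - f (u s)‖ ≤ ε := by
  have hdist : dist (u + ContinuousMap.const K (y - u s)) u < δ := by
    rw [dist_eq_norm, add_sub_cancel_left]
    exact (ContinuousMap.norm_lt_iff _ hδ).2 fun _ => mem_ball_iff_norm.1 hy
  simpa only [ContinuousMap.comp_apply, ContinuousMap.add_apply, ContinuousMap.const_apply,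
    add_sub_cancel, dist_eq_norm] using (ContinuousMap.dist_apply_le_dist s).trans (hf hdist).le

theorem hasFDerivAt_superposition {X Y : Type*} [NormedAddCommGroup X] [NormedSpace ℝ X]
    [NormedAddCommGroup Y] [NormedSpace ℝ Y] (f : C(X, Y)) (f' : C(X, X →L[ℝ] Y))
    (hf : ∀ x, HasFDerivAt f (f' x) x) (u : C(K, X)) :
    HasFDerivAt (fun v : C(K, X) => f.comp v) (pointwiseApply K X Y (f'.comp u)) u := by
  rw [hasFDerivAt_iff_isLittleO, Asymptotics.isLittleO_iff]
  intro ε hε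
  obtain ⟨δ, hδ, hball⟩ := (Metric.continuousAt_iff (α := C(K, X)) (β := C(K, X →L[ℝ] Y))).1
    (ContinuousMap.continuous_postcomp f').continuousAt ε hε
  filter_upwards [Metric.ball_mem_nhds u hδ] with v hv
  refine (ContinuousMap.norm_le _ (by positivity)).2 fun s => ?_
  have hs : ‖v s - u s‖ ≤ ‖v - u‖ := (v - u).norm_coe_le_norm s
  have hvs : v s ∈ Metric.ball (u s) δ :=
    mem_ball_iff_norm.2 (hs.trans_lt (mem_ball_iff_norm.1 hv))
  have hmv := (convex_ball (u s) δ).norm_image_sub_le_of_norm_hasFDerivWithin_le'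
    (fun y _ => (hf y).hasFDerivWithinAt)
    (fun y hy => norm_sub_le_of_dist_postcomp_lt hδ hball s hy) (Metric.mem_ball_self hδ) hvs
  calc _ = ‖f (v s) - f (u s) - f' (u s) (v s - u s)‖ := by simp
    _ ≤ ε * ‖v s - u s‖ := hmv
    _ ≤ ε * ‖v - u‖ := by gcongr

theorem contDiff_superposition_nat {X : Type v} [NormedAddCommGroup X] [NormedSpace ℝ X] (n : ℕ) :
    ∀ {Y : Type max v w} [NormedAddCommGroup Y] [NormedSpace ℝ Y] (f : C(X, Y)), ContDiff ℝ n f →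
      ContDiff ℝ n (fun v : C(K, X) => f.comp v) := by
  induction n with
  | zero =>
    intro Y _ _ f _
    exact contDiff_zero.2 (ContinuousMap.continuous_postcomp f)
  | succ n ih =>
    intro Y _ _ f hf
    obtain ⟨f', hf', hd⟩ := contDiff_succ_iff_hasFDerivAt.1 hf
    let F' : C(X, X →L[ℝ] Y) := ⟨f', hf'.continuous⟩
    refine contDiff_succ_iff_hasFDerivAt.2
      ⟨fun u => pointwiseApply K X Y (F'.comp u), ?_, hasFDerivAt_superposition f F' hd⟩
    exact (pointwiseApply K X Y).contDiff.comp (ih F' hf')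

theorem contDiff_superposition {X : Type v} [NormedAddCommGroup X] [NormedSpace ℝ X]
    {Y : Type max v w} [NormedAddCommGroup Y] [NormedSpace ℝ Y] {f : C(X, Y)}
    (hf : ContDiff ℝ ∞ f) : ContDiff ℝ ∞ (fun v : C(K, X) => f.comp v) :=
  contDiff_infty.2 fun n => contDiff_superposition_nat n f (contDiff_infty.1 hf n)

end

section

open scoped unitInterval

theorem exists_contDiffAt_implicitFunction {E₁ E₂ F : Type*} [NormedAddCommGroup E₁]
    [NormedSpace ℝ E₁] [CompleteSpace E₁] [NormedAddCommGroup E₂] [NormedSpace ℝ E₂]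
    [CompleteSpace E₂] [NormedAddCommGroup F] [NormedSpace ℝ F] [CompleteSpace F]
    {f : E₁ × E₂ → F} (hf : ContDiff ℝ ∞ f) {p : E₁ × E₂}
    (hp : (fderiv ℝ f p ∘L .inr ℝ E₁ E₂).IsInvertible) :
    ∃ φ : E₁ → E₂, φ p.1 = p.2 ∧ (∀ᶠ x in 𝓝 p.1, ContDiffAt ℝ ∞ φ x ∧ f (x, φ x) = f p) ∧
      ∀ᶠ v in 𝓝 p, f v = f p → φ v.1 = v.2 := by
  have hne : (∞ : WithTop ℕ∞) ≠ 0 := by simp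
  set φ := hf.contDiffAt.implicitFunction hne hp
  have hφp : φ p.1 = p.2 := hf.contDiffAt.implicitFunction_apply_self hne hp
  have hφ₁ : ContDiffAt ℝ 1 φ p.1 :=
    (hf.contDiffAt.contDiffAt_implicitFunction hne hp).of_le (by simp)
  have hgraph : Filter.Tendsto (fun x => (x, φ x)) (𝓝 p.1) (𝓝 p) := by
    have := (continuousAt_id (x := p.1)).prodMk hφ₁.continuousAt
    rwa [ContinuousAt, hφp] at this
  have hsol : ∀ᶠ x in 𝓝 p.1, f (x, φ x) = f p :=
    hf.contDiffAt.eventually_apply_implicitFunction hne hp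
  have huniq : ∀ᶠ v in 𝓝 p, f v = f p ↔ φ v.1 = v.2 :=
    hf.contDiffAt.eventually_apply_eq_iff_implicitFunction hne hp
  have hinv : ∀ᶠ v in 𝓝 p, (fderiv ℝ f v ∘L .inr ℝ E₁ E₂).IsInvertible := by
    obtain ⟨e, he⟩ := hp
    have hcont : Continuous fun v => fderiv ℝ f v ∘L .inr ℝ E₁ E₂ :=
      (hf.continuous_fderiv hne).clm_comp continuous_const
    have hmem := hcont.continuousAt.eventually_mem (he ▸ e.nhds)
    exact hmem
  refine ⟨φ, hφp, ?_, huniq.mono fun v hv => hv.1⟩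
  filter_upwards [eventually_eventually_nhds.2 hsol, hgraph.eventually hinv,
    hφ₁.eventually (by simp)] with x hx hxinv hx₁
  -- Near `x` the function `φ` coincides with the implicit function of `f` based at `(x, φ x)`.
  have hgraphx : Filter.Tendsto (fun y => (y, φ y)) (𝓝 x) (𝓝 (x, φ x)) :=
    continuousAt_id.prodMk hx₁.continuousAt
  refine ⟨(hf.contDiffAt.contDiffAt_implicitFunction hne hxinv).congr_of_eventuallyEq ?_,
    hx.self_of_nhds⟩
  filter_upwards [hx, hgraphx.eventually
    (hf.contDiffAt.eventually_apply_eq_iff_implicitFunction hne hxinv)] with y hy hyx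
  exact (hyx.1 (hy.trans hx.self_of_nhds.symm)).symm

variable {Z : Type*} [NormedAddCommGroup Z] [NormedSpace ℝ Z]

variable (Z) in
/-- The operator taking a continuous function on the unit interval to its primitive vanishing
at `0`. -/
def primitive : C(I, Z) →L[ℝ] C(I, Z) :=
  have hcont (u : C(I, Z)) : Continuous fun τ : ℝ => u (Set.projIcc 0 1 zero_le_one τ) :=
    u.continuous.comp continuous_projIcc
  LinearMap.mkContinuous (E := C(I, Z)) (F := C(I, Z))
    { toFun := fun u =>
        { toFun := fun s => ∫ τ in (0 : ℝ)..s, u (Set.projIcc 0 1 zero_le_one τ)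
          continuous_toFun := (intervalIntegral.continuous_primitive
            (fun a b => (hcont u).intervalIntegrable a b) 0).comp continuous_subtype_val }
      map_add' := fun u v => by
        ext s
        exact intervalIntegral.integral_add ((hcont u).intervalIntegrable _ _)
          ((hcont v).intervalIntegrable _ _)
      map_smul' := fun c u => by
        ext s
        exact intervalIntegral.integral_smul c _ } 1 fun u => by
    rw [one_mul]
    refine (ContinuousMap.norm_le _ (by positivity)).2 fun s => ?_
    have h := intervalIntegral.norm_integral_le_of_norm_le_const (a := 0) (b := (s : ℝ))
      (f := fun τ : ℝ => u (Set.projIcc 0 1 zero_le_one τ)) fun τ _ => u.norm_coe_le_norm _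
    refine h.trans (mul_le_of_le_one_right (norm_nonneg _) ?_)
    rw [sub_zero, abs_of_nonneg s.2.1]
    exact s.2.2

theorem primitive_apply (u : C(I, Z)) (s : I) :
    primitive Z u s = ∫ τ in (0 : ℝ)..s, u (Set.projIcc 0 1 zero_le_one τ) := rfl

theorem primitive_comp_mul (u : C(I, Z)) (s r : I) :
    (s : ℝ) • primitive Z (u.comp ⟨(s * ·), continuous_const_mul s⟩) r =
      primitive Z u (s * r) := by
  have h := intervalIntegral.smul_integral_comp_mul_left (a := 0) (b := (r : ℝ))
    (fun τ : ℝ => u (Set.projIcc 0 1 zero_le_one τ)) (s : ℝ)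
  rw [mul_zero] at h
  rw [primitive_apply, primitive_apply, Set.Icc.coe_mul, ← h]
  congr 1
  refine intervalIntegral.integral_congr fun τ hτ => ?_
  rw [Set.uIcc_of_le r.2.1] at hτ
  have hτ1 : τ ∈ Set.Icc (0 : ℝ) 1 := ⟨hτ.1, hτ.2.trans r.2.2⟩
  have hτ2 : (s : ℝ) * τ ∈ Set.Icc (0 : ℝ) 1 :=
    ⟨mul_nonneg s.2.1 hτ1.1, mul_le_one₀ s.2.2 hτ1.1 hτ1.2⟩
  simp only [ContinuousMap.comp_apply, ContinuousMap.coe_mk, Set.projIcc_of_mem _ hτ1,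
    Set.projIcc_of_mem _ hτ2]
  rfl

/-- The defect of `u` as a solution on the unit interval of `u' = a • f u`, `u 0 = z`, for the
data `((z, a), u)`. Scaling by `a` trades the length of the interval of existence for a parameter,
to which the implicit function theorem applies. -/
def flowDefect (f : C(Z, Z)) (p : (Z × ℝ) × C(I, Z)) : C(I, Z) :=
  p.2 - ContinuousMap.const I p.1.1 - p.1.2 • primitive Z (f.comp p.2)

theorem flowDefect_eq_zero_iff (f : C(Z, Z)) {z : Z} {a : ℝ} {u : C(I, Z)} :
    flowDefect f ((z, a), u) = 0 ↔ ∀ s, u s = z + a • primitive Z (f.comp u) s := by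
  rw [flowDefect, sub_sub, sub_eq_zero, ContinuousMap.ext_iff]
  rfl

theorem contDiff_flowDefect {f : C(Z, Z)} (hf : ContDiff ℝ ∞ f) :
    ContDiff ℝ ∞ (flowDefect f) := by
  have hconst : ContDiff ℝ ∞ fun p : (Z × ℝ) × C(I, Z) => ContinuousMap.const I p.1.1 :=
    (ContinuousLinearMap.const ℝ I (M := Z)).contDiff.comp (contDiff_fst.comp contDiff_fst)
  have hprim : ContDiff ℝ ∞ fun p : (Z × ℝ) × C(I, Z) => primitive Z (f.comp p.2) :=
    (primitive Z).contDiff.comp ((contDiff_superposition hf).comp contDiff_snd)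
  exact (contDiff_snd.sub hconst).sub ((contDiff_snd.comp contDiff_fst).smul hprim)

theorem flowDefect_rescale {f : C(Z, Z)} {z : Z} {a : ℝ} {u : C(I, Z)}
    (h : flowDefect f ((z, a), u) = 0) (s : I) :
    flowDefect f ((z, s * a), u.comp ⟨(s * ·), continuous_const_mul s⟩) = 0 := by
  rw [flowDefect_eq_zero_iff] at h ⊢
  intro r
  rw [mul_comm, mul_smul, ← ContinuousMap.comp_assoc, primitive_comp_mul]
  exact h (s * r)

theorem fderiv_flowDefect_comp_inr {f : C(Z, Z)} (hf : ContDiff ℝ ∞ f) (z : Z) (u : C(I, Z)) :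
    fderiv ℝ (flowDefect f) ((z, 0), u) ∘L .inr ℝ (Z × ℝ) C(I, Z) = .id ℝ C(I, Z) := by
  have h := (((contDiff_flowDefect hf).differentiable (by simp) ((z, 0), u)).hasFDerivAt).comp u
    (hasFDerivAt_prodMk_right ((z, 0) : Z × ℝ) u)
  have heq : (flowDefect f ∘ fun u : C(I, Z) => ((z, 0), u)) =
      fun u => u - ContinuousMap.const I z := by
    funext u
    simp only [Function.comp_apply, flowDefect, zero_smul, sub_zero]
  rw [heq] at h
  exact h.unique ((hasFDerivAt_id u).sub_const _)

theorem exists_flowDefect_eq_zero [CompleteSpace Z] {f : C(Z, Z)} (hf : ContDiff ℝ ∞ f) (z₀ : Z) :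
    ∃ U : Z × ℝ → C(I, Z), ∃ r > 0, ∀ p ∈ Metric.ball (z₀, 0) r, ContDiffAt ℝ ∞ U p ∧
      flowDefect f (p, U p) = 0 ∧ ∀ s : I, U (p.1, s * p.2) = (U p).comp ⟨(s * ·),
        continuous_const_mul s⟩ := by
  have h₀ : flowDefect f ((z₀, 0), ContinuousMap.const I z₀) = 0 :=
    (flowDefect_eq_zero_iff f).2 fun s => by simp
  obtain ⟨U, hU₀, hU, huniq⟩ := exists_contDiffAt_implicitFunction
    (p := ((z₀, 0), ContinuousMap.const I z₀)) (contDiff_flowDefect hf)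
    (by rw [fderiv_flowDefect_comp_inr hf]; exact ⟨.refl ℝ _, rfl⟩)
  simp only [h₀] at hU₀ hU huniq
  obtain ⟨δ, hδ, huniq⟩ := Metric.eventually_nhds_iff.1 huniq
  have hnear : ∀ᶠ p in 𝓝 (z₀, 0), dist (U p) (ContinuousMap.const I z₀) < δ := by
    have h := hU.self_of_nhds.1.continuousAt.tendsto
    rw [hU₀] at h
    exact h (Metric.ball_mem_nhds _ hδ)
  obtain ⟨r, hr, hball⟩ := Metric.eventually_nhds_iff.1 (hU.and hnear)
  refine ⟨U, min r δ, lt_min hr hδ, fun p hp => ?_⟩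
  obtain ⟨⟨hsmooth, hsol⟩, hUp⟩ := hball (hp.trans_le (min_le_left _ _))
  refine ⟨hsmooth, hsol, fun s => huniq ?_ (flowDefect_rescale hsol s)⟩
  have hsp : dist (p.1, (s : ℝ) * p.2) (z₀, 0) ≤ dist p (z₀, 0) := by
    simp only [Prod.dist_eq, Real.dist_eq, sub_zero, abs_mul, abs_of_nonneg s.2.1]
    exact max_le_max le_rfl (mul_le_of_le_one_left (abs_nonneg _) s.2.2)
  refine max_lt (hsp.trans_lt (hp.trans_le (min_le_right _ _))) (lt_of_le_of_lt ?_ hUp)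
  exact (ContinuousMap.dist_le dist_nonneg).2 fun τ =>
    ContinuousMap.dist_apply_le_dist (f := U p) (g := ContinuousMap.const I z₀) (s * τ)

theorem apply_one_eq_integral {f : C(Z, Z)} {U : Z × ℝ → C(I, Z)} {z : Z} {a : ℝ}
    (hU : flowDefect f ((z, a), U (z, a)) = 0)
    (hscale : ∀ s : I, U (z, s * a) = (U (z, a)).comp ⟨(s * ·), continuous_const_mul s⟩) :
    U (z, a) 1 = z + ∫ y in (0 : ℝ)..a, f (U (z, y) 1) := by
  have hsubst := intervalIntegral.smul_integral_comp_mul_left (a := 0) (b := 1)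
    (fun y => f (U (z, y) 1)) a
  rw [mul_zero, mul_one] at hsubst
  rw [(flowDefect_eq_zero_iff f).1 hU 1, primitive_apply, Set.Icc.coe_one, ← hsubst]
  congr 2
  refine intervalIntegral.integral_congr fun τ hτ => ?_
  rw [Set.uIcc_of_le zero_le_one] at hτ
  have h := congrArg (fun u : C(I, Z) => f (u 1)) (hscale ⟨τ, hτ⟩)
  simp only [ContinuousMap.comp_apply, ContinuousMap.coe_mk, mul_one] at h
  simp only [ContinuousMap.comp_apply, Set.projIcc_of_mem _ hτ, mul_comm a, h]

theorem exists_local_flow [CompleteSpace Z] {f : Z → Z} (hf : ContDiff ℝ ∞ f) (z₀ : Z) :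
    ∃ Φ : Z × ℝ → Z, ∃ r > 0, ∀ z ∈ Metric.ball z₀ r, Φ (z, 0) = z ∧
      ∀ a ∈ Metric.ball (0 : ℝ) r, ContDiffAt ℝ ∞ Φ (z, a) ∧
        HasDerivAt (fun a => Φ (z, a)) (f (Φ (z, a))) a := by
  obtain ⟨U, r, hr, hU⟩ := exists_flowDefect_eq_zero (f := ⟨f, hf.continuous⟩) hf z₀
  have hbox {z : Z} (hz : z ∈ Metric.ball z₀ r) {a : ℝ} (ha : a ∈ Metric.ball (0 : ℝ) r) :
      (z, a) ∈ Metric.ball ((z₀, 0) : Z × ℝ) r :=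
    ball_prod_same z₀ (0 : ℝ) r ▸ ⟨hz, ha⟩
  have hint {z : Z} (hz : z ∈ Metric.ball z₀ r) {a : ℝ} (ha : a ∈ Metric.ball (0 : ℝ) r) :
      U (z, a) 1 = z + ∫ y in (0 : ℝ)..a, f (U (z, y) 1) :=
    apply_one_eq_integral (hU _ (hbox hz ha)).2.1 (hU _ (hbox hz ha)).2.2
  refine ⟨fun p => U p 1, r, hr, fun z hz => ⟨?_, fun a ha => ?_⟩⟩
  · exact (hint hz (Metric.mem_ball_self hr)).trans (by simp)
  have hsmooth {b : ℝ} (hb : b ∈ Metric.ball (0 : ℝ) r) :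
      ContDiffAt ℝ ∞ (fun p => U p 1) (z, b) :=
    (ContinuousMap.evalCLM ℝ (1 : I) : C(I, Z) →L[ℝ] Z).contDiff.contDiffAt.comp (z, b)
      (hU _ (hbox hz hb)).1
  have hcont : ContinuousOn (fun y => f (U (z, y) 1)) (Metric.ball 0 r) := fun y hy =>
    (hf.continuous.continuousAt.comp ((hsmooth hy).continuousAt.comp
      (Continuous.prodMk_right z).continuousAt)).continuousWithinAt
  have hftc := intervalIntegral.integral_hasDerivAt_right
    (hcont.mono ((convex_ball (0 : ℝ) r).ordConnected.uIcc_subset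
      (Metric.mem_ball_self hr) ha)).intervalIntegrable
    (hcont.stronglyMeasurableAtFilter Metric.isOpen_ball a ha)
    (hcont.continuousAt (Metric.isOpen_ball.mem_nhds ha))
  refine ⟨hsmooth ha, (hftc.const_add z).congr_of_eventuallyEq ?_⟩
  filter_upwards [Metric.isOpen_ball.mem_nhds ha] with b hb using hint hz hb

theorem snd_flow_eq {X P : Type*} [NormedAddCommGroup X] [NormedSpace ℝ X]
    [NormedAddCommGroup P] [NormedSpace ℝ P] {γ : ℝ → X × ℝ × P} {g : ℝ → X} {r : ℝ}
    (hr : 0 < r) (hγ : ∀ a ∈ Metric.ball (0 : ℝ) r, HasDerivAt γ (g a, 1, 0) a) {a : ℝ}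
    (ha : a ∈ Metric.ball (0 : ℝ) r) : (γ a).2 = ((γ 0).2.1 + a, (γ 0).2.2) := by
  have hleft (b : ℝ) (hb : b ∈ Metric.ball (0 : ℝ) r) :
      HasDerivAt (fun a => (γ a).2) (1, 0) b := (hγ b hb).snd
  have hright (b : ℝ) :
      HasDerivAt (fun a => ((γ 0).2.1 + a, (γ 0).2.2)) ((1 : ℝ), (0 : P)) b :=
    ((hasDerivAt_id b).const_add _).prodMk (hasDerivAt_const b _)
  exact Metric.isOpen_ball.eqOn_of_deriv_eq (convex_ball (0 : ℝ) r).isPreconnected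
    (fun b hb => (hleft b hb).differentiableAt.differentiableWithinAt)
    (fun b _ => (hright b).differentiableAt.differentiableWithinAt)
    (fun b hb => (hleft b hb).deriv.trans (hright b).deriv.symm)
    (Metric.mem_ball_self hr) (by simp) ha

theorem exists_local_solution {X P : Type*} [NormedAddCommGroup X] [NormedSpace ℝ X]
    [CompleteSpace X] [NormedAddCommGroup P] [NormedSpace ℝ P] [CompleteSpace P]
    {f : X × ℝ × P → X} (hf : ContDiff ℝ ∞ f) (x₀ : X) (b : ℝ) (p₀ : P) :
    ∃ u : ℝ × P → X, u (b, p₀) = x₀ ∧ ∀ᶠ q in 𝓝 (b, p₀), ContDiffAt ℝ ∞ u q ∧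
      HasDerivAt (fun s => u (s, q.2)) (f (u q, q)) q.1 := by
  obtain ⟨Φ, r, hr, hΦ⟩ := exists_local_flow (f := fun w => (f w, (1 : ℝ), (0 : P)))
    (hf.prodMk contDiff_const) (x₀, b, p₀)
  have hinit {p : P} (hp : p ∈ Metric.ball p₀ r) :
      (x₀, b, p) ∈ Metric.ball (x₀, b, p₀) r := by
    simpa only [Metric.mem_ball, Prod.dist_eq, dist_self, max_lt_iff, hr, true_and] using hp
  refine ⟨fun q => (Φ ((x₀, b, q.2), q.1 - b)).1, ?_, ?_⟩
  · simp only [sub_self, (hΦ _ (hinit (Metric.mem_ball_self hr))).1]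
  filter_upwards [Metric.ball_mem_nhds _ hr] with ⟨s, p⟩ hq
  rw [← ball_prod_same] at hq
  obtain ⟨hs, hp⟩ := hq
  have ha : s - b ∈ Metric.ball (0 : ℝ) r := by rwa [mem_ball_zero_iff, ← dist_eq_norm]
  obtain ⟨hzero, hflow⟩ := hΦ _ (hinit hp)
  have hsnd := snd_flow_eq hr (fun a ha => (hflow a ha).2) ha
  have hΦs : Φ ((x₀, b, p), s - b) = ((Φ ((x₀, b, p), s - b)).1, s, p) :=
    Prod.ext rfl (by simpa only [hzero, add_sub_cancel] using hsnd)
  constructor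
  · exact (hflow _ ha).1.fst.comp (s, p) (f := fun q : ℝ × P => ((x₀, b, q.2), q.1 - b))
      (by fun_prop)
  · have hderiv : HasDerivAt (fun a => (Φ ((x₀, b, p), a)).1) (f (Φ ((x₀, b, p), s - b))) (s - b) :=
      (hflow _ ha).2.fst
    rw [hΦs] at hderiv
    exact hderiv.comp_sub_const s b

end

section

/-! ### Curves in the group with prescribed logarithmic derivative -/

variable {E : Type*} [NormedAddCommGroup E] [NormedSpace ℝ E]

theorem exists_contDiff_eventuallyEq [HasContDiffBump E] {F : Type*} [NormedAddCommGroup F]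
    [NormedSpace ℝ F] {f : E → F} {x : E} (hf : ∀ᶠ y in 𝓝 x, ContDiffAt ℝ ∞ f y) :
    ∃ g : E → F, ContDiff ℝ ∞ g ∧ g =ᶠ[𝓝 x] f := by
  obtain ⟨r, hr, hfr⟩ := Metric.nhds_basis_closedBall.eventually_iff.1 hf
  let b : ContDiffBump x := ⟨r / 2, r, half_pos hr, half_lt_self hr⟩
  refine ⟨fun y => b y • f y, contDiff_iff_contDiffAt.2 fun y => ?_, ?_⟩
  · by_cases hy : y ∈ Metric.closedBall x r
    · exact b.contDiffAt.smul (hfr hy)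
    · refine (contDiffAt_const (c := (0 : F))).congr_of_eventuallyEq ?_
      filter_upwards [Metric.isClosed_closedBall.isOpen_compl.mem_nhds hy] with z hz
      rw [b.zero_of_le_dist (not_le.1 fun h => hz (Metric.mem_closedBall.2 h)).le, zero_smul]
  · filter_upwards [b.eventuallyEq_one] with y hy
    rw [hy, Pi.one_apply, one_smul]

variable {G : Type*} [TopologicalSpace G] [ChartedSpace E G] [Group G] [LieGroup 𝓘(ℝ, E) ∞ G]

variable (E G) in
theorem eventually_leftD_injective :
    ∀ᶠ u in 𝓝 (chartOne E G), Function.Injective (leftD E G u) := by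
  have h := (contDiffAt_leftD (E := E) (G := G)).continuousAt
  rw [ContinuousAt, leftD_one] at h
  filter_upwards [h (Metric.ball_mem_nhds _ one_pos)] with u hu
  rw [injective_iff_map_eq_zero]
  intro v hv
  by_contra hne
  have hle := (leftD E G u - ContinuousLinearMap.id ℝ E).le_opNorm v
  rw [sub_apply, hv, zero_sub, norm_neg, ContinuousLinearMap.id_apply, ← dist_eq_norm] at hle
  have hlt : dist (leftD E G u) (ContinuousLinearMap.id ℝ E) < 1 := hu
  nlinarith [norm_pos_iff.2 hne]

theorem mdifferentiableAt_extChartAt_symm_comp {γ : ℝ → E} {x : ℝ} (hγ : DifferentiableAt ℝ γ x)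
    (hx : γ x ∈ (extChartAt 𝓘(ℝ, E) (1 : G)).target) :
    MDifferentiableAt 𝓘(ℝ, ℝ) 𝓘(ℝ, E) (fun s => (extChartAt 𝓘(ℝ, E) (1 : G)).symm (γ s)) x := by
  have : IsManifold 𝓘(ℝ, E) 1 G := IsManifold.of_le (n := ∞) (by simp)
  exact MDifferentiableAt.comp x (((contMDiffOn_extChartAt_symm (1 : G)).contMDiffAt
    ((isOpen_extChartAt_target 1).mem_nhds hx)).mdifferentiableAt one_ne_zero)
    hγ.mdifferentiableAt

theorem logDeriv_extChartAt_symm_comp {γ : ℝ → E} {x : ℝ} {w : E}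
    (hx : γ x ∈ (extChartAt 𝓘(ℝ, E) (1 : G)).target)
    (hinj : Function.Injective (leftD E G (γ x))) (hγ : HasDerivAt γ (leftD E G (γ x) w) x) :
    logDeriv E (fun s => (extChartAt 𝓘(ℝ, E) (1 : G)).symm (γ s)) x = w := by
  set c := extChartAt 𝓘(ℝ, E) (1 : G)
  have hsrc : c.symm (γ x) ∈ (chartAt E (1 : G)).source := by
    simpa only [c, extChartAt_source] using c.map_target hx
  have hchart := hasDerivAt_extChartAt_comp
    (mdifferentiableAt_extChartAt_symm_comp hγ.differentiableAt hx) hsrc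
  have hcomp : (fun s => c (c.symm (γ s))) =ᶠ[𝓝 x] γ := by
    filter_upwards [hγ.continuousAt.preimage_mem_nhds ((isOpen_extChartAt_target 1).mem_nhds hx)]
      with s hs using c.right_inv hs
  have heq := (hchart.congr_of_eventuallyEq hcomp.symm).unique hγ
  rw [c.right_inv hx] at heq
  exact hinj heq

theorem exists_local_logDeriv_eq [FiniteDimensional ℝ E] {P : Type*} [NormedAddCommGroup P]
    [NormedSpace ℝ P] [CompleteSpace P] {C : ℝ × P → E} (hC : ContDiff ℝ ∞ C) (b : ℝ) (p₀ : P) :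
    ∃ φ : ℝ × P → G, ∀ᶠ q in 𝓝 (b, p₀), ContMDiffAt 𝓘(ℝ, ℝ × P) 𝓘(ℝ, E) ∞ φ q ∧
      logDeriv E (fun x => φ (x, q.2)) q.1 = C q := by
  have : CompleteSpace E := FiniteDimensional.complete ℝ E
  obtain ⟨F, hF, hFeq⟩ := exists_contDiff_eventuallyEq (f := leftD E G) (x := chartOne E G)
    (by filter_upwards [target_mem_nhds_chartOne (E := E) (G := G)] with u hu
          using contDiffAt_leftD_of_mem hu)
  obtain ⟨u, hu₀, hu⟩ := exists_local_solution (f := fun w : E × ℝ × P => F w.1 (C w.2))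
    ((hF.comp contDiff_fst).clm_apply (hC.comp contDiff_snd)) (chartOne E G) b p₀
  have hlim : Filter.Tendsto u (𝓝 (b, p₀)) (𝓝 (chartOne E G)) :=
    hu₀ ▸ hu.self_of_nhds.1.continuousAt.tendsto
  refine ⟨fun q => (extChartAt 𝓘(ℝ, E) (1 : G)).symm (u q), ?_⟩
  filter_upwards [hu, hlim.eventually hFeq, hlim.eventually (eventually_leftD_injective E G),
    hlim.eventually target_mem_nhds_chartOne] with q ⟨hsmooth, hderiv⟩ hFq hinj hq
  rw [hFq] at hderiv
  exact ⟨ContMDiffAt.comp q ((contMDiffOn_extChartAt_symm (1 : G)).contMDiffAt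
    ((isOpen_extChartAt_target 1).mem_nhds hq)) hsmooth.contMDiffAt,
    logDeriv_extChartAt_symm_comp (γ := fun x => u (x, q.2)) hq hinj hderiv⟩

end

section

variable {E : Type*} [NormedAddCommGroup E] [NormedSpace ℝ E]
  {G : Type*} [TopologicalSpace G] [ChartedSpace E G] [Group G]

theorem logDeriv_congr {f k : ℝ → G} {x : ℝ} (h : f =ᶠ[𝓝 x] k) :
    logDeriv E f x = logDeriv E k x := by
  have hleft : (fun s : ℝ => (f x)⁻¹ * f s) =ᶠ[𝓝 x] fun s => (k x)⁻¹ * k s := by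
    filter_upwards [h] with s hs
    rw [hs, h.self_of_nhds]
  exact DFunLike.congr_fun hleft.mfderiv_eq (1 : ℝ)

variable {P : Type*} [NormedAddCommGroup P] [NormedSpace ℝ P]

/-- `φ` is a smooth family, over the open box `J ×ˢ V`, of solutions `x ↦ φ (x, p)` of the
differential equation `φ⁻¹ φ_x = C`. -/
structure IsDevelopmentOn (C : ℝ × P → E) (φ : ℝ × P → G) (J : Set ℝ) (V : Set P) : Prop where
  isOpen_fst : IsOpen J
  isPreconnected_fst : IsPreconnected J
  isOpen_snd : IsOpen V
  contMDiffAt : ∀ q ∈ J ×ˢ V, ContMDiffAt 𝓘(ℝ, ℝ × P) 𝓘(ℝ, E) ∞ φ q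
  logDeriv_eq : ∀ q ∈ J ×ˢ V, logDeriv E (fun x => φ (x, q.2)) q.1 = C q

namespace IsDevelopmentOn

variable {C : ℝ × P → E} {φ κ : ℝ × P → G} {J J' : Set ℝ} {V V' : Set P}

theorem mdifferentiableAt_fst (h : IsDevelopmentOn C φ J V) {x : ℝ} (hx : x ∈ J) {p : P}
    (hp : p ∈ V) : MDifferentiableAt 𝓘(ℝ, ℝ) 𝓘(ℝ, E) (fun x => φ (x, p)) x :=
  MDifferentiableAt.comp x ((h.contMDiffAt (x, p) ⟨hx, hp⟩).mdifferentiableAt (by simp))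
    ((differentiableAt_id.prodMk (differentiableAt_const p)).mdifferentiableAt)

theorem contMDiffAt_snd (h : IsDevelopmentOn C φ J V) {x : ℝ} (hx : x ∈ J) {p : P}
    (hp : p ∈ V) : ContMDiffAt 𝓘(ℝ, P) 𝓘(ℝ, E) ∞ (fun p => φ (x, p)) p :=
  ContMDiffAt.comp p (h.contMDiffAt (x, p) ⟨hx, hp⟩)
    (contDiff_const.prodMk contDiff_id).contMDiff.contMDiffAt

theorem mono (h : IsDevelopmentOn C φ J V) (hJ' : IsOpen J') (hJ'' : IsPreconnected J')
    (hJJ' : J' ⊆ J) (hV' : IsOpen V') (hVV' : V' ⊆ V) : IsDevelopmentOn C φ J' V' where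
  isOpen_fst := hJ'
  isPreconnected_fst := hJ''
  isOpen_snd := hV'
  contMDiffAt q hq := h.contMDiffAt q ⟨hJJ' hq.1, hVV' hq.2⟩
  logDeriv_eq q hq := h.logDeriv_eq q ⟨hJJ' hq.1, hVV' hq.2⟩

theorem congr (h : IsDevelopmentOn C φ J V) (heq : Set.EqOn κ φ (J ×ˢ V)) :
    IsDevelopmentOn C κ J V where
  __ := h
  contMDiffAt q hq := (h.contMDiffAt q hq).congr_of_eventuallyEq
    (heq.eventuallyEq_of_mem ((h.isOpen_fst.prod h.isOpen_snd).mem_nhds hq))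
  logDeriv_eq q hq := (logDeriv_congr (heq.eventuallyEq_of_mem
    ((h.isOpen_fst.prod h.isOpen_snd).mem_nhds hq) |>.comp_tendsto
      ((Continuous.prodMk_left q.2).tendsto q.1))).trans (h.logDeriv_eq q hq)

theorem union (h : IsDevelopmentOn C φ J V) (h' : IsDevelopmentOn C φ J' V) {y : ℝ} (hy : y ∈ J)
    (hy' : y ∈ J') : IsDevelopmentOn C φ (J ∪ J') V where
  isOpen_fst := h.isOpen_fst.union h'.isOpen_fst
  isPreconnected_fst := h.isPreconnected_fst.union y hy hy' h'.isPreconnected_fst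
  isOpen_snd := h.isOpen_snd
  contMDiffAt q hq := hq.1.elim (fun hJ => h.contMDiffAt q ⟨hJ, hq.2⟩)
    (fun hJ' => h'.contMDiffAt q ⟨hJ', hq.2⟩)
  logDeriv_eq q hq := hq.1.elim (fun hJ => h.logDeriv_eq q ⟨hJ, hq.2⟩)
    (fun hJ' => h'.logDeriv_eq q ⟨hJ', hq.2⟩)

end IsDevelopmentOn

variable [LieGroup 𝓘(ℝ, E) ∞ G]

theorem hasDerivAt_comp_of_logDeriv_eq_zero {W : Type*} [NormedAddCommGroup W] [NormedSpace ℝ W]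
    {Φ : G → W} {f : ℝ → G} {x : ℝ} (hΦ : MDifferentiableAt 𝓘(ℝ, E) 𝓘(ℝ, W) Φ (f x))
    (hf : MDifferentiableAt 𝓘(ℝ, ℝ) 𝓘(ℝ, E) f x) (h : logDeriv E f x = 0) :
    HasDerivAt (fun s => Φ (f s)) 0 x := by
  have hΦleft : MDifferentiableAt 𝓘(ℝ, E) 𝓘(ℝ, W) (fun g => Φ (f x * g)) 1 := by
    refine MDifferentiableAt.comp (1 : G) ?_
      ((contMDiff_mul_left (n := ∞)).mdifferentiable (by simp) 1)
    rwa [mul_one]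
  have hderiv := hasDerivAt_comp_of_eq_one hΦleft (mdifferentiableAt_const_mul hf (f x)⁻¹)
    (inv_mul_cancel _)
  have hvel : velocity E (fun s => (f x)⁻¹ * f s) x = 0 := h
  rw [hvel, map_zero] at hderiv
  simpa only [mul_inv_cancel_left] using hderiv

theorem eventually_eq_of_logDeriv_eq_zero {f : ℝ → G} {x : ℝ}
    (h : ∀ᶠ s in 𝓝 x, MDifferentiableAt 𝓘(ℝ, ℝ) 𝓘(ℝ, E) f s ∧ logDeriv E f s = 0) :
    ∀ᶠ y in 𝓝 x, f x = f y := by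
  have : IsManifold 𝓘(ℝ, E) 1 G := IsManifold.of_le (n := ∞) (by simp)
  let c := extChartAt 𝓘(ℝ, E) (f x)
  have hsrc : ∀ᶠ s in 𝓝 x, f s ∈ c.source :=
    h.self_of_nhds.1.continuousAt (extChartAt_source_mem_nhds (f x))
  obtain ⟨r, hr, hball⟩ := Metric.eventually_nhds_iff_ball.1 (h.and hsrc)
  have hderiv : ∀ s ∈ Metric.ball x r, HasDerivAt (fun s => c (f s)) 0 s := fun s hs =>
    hasDerivAt_comp_of_logDeriv_eq_zero
      (mdifferentiableAt_extChartAt (by simpa only [c, extChartAt_source] using (hball s hs).2))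
      (hball s hs).1.1 (hball s hs).1.2
  filter_upwards [Metric.ball_mem_nhds x hr] with y hy
  have hx := Metric.mem_ball_self (x := x) hr
  exact c.injOn (hball x hx).2 (hball y hy).2 (Metric.isOpen_ball.is_const_of_deriv_eq_zero
    (convex_ball x r).isPreconnected
    (fun s hs => (hderiv s hs).differentiableAt.differentiableWithinAt)
    (fun s hs => (hderiv s hs).deriv) hx hy)

theorem eq_of_logDeriv_eq_zero {f : ℝ → G} {J : Set ℝ} (hJ : IsOpen J) (hJ' : IsPreconnected J)
    (hf : ∀ x ∈ J, MDifferentiableAt 𝓘(ℝ, ℝ) 𝓘(ℝ, E) f x) (h : ∀ x ∈ J, logDeriv E f x = 0)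
    {x y : ℝ} (hx : x ∈ J) (hy : y ∈ J) : f x = f y :=
  hJ'.induction₂ (fun x y => f x = f y)
    (fun _ hx => nhdsWithin_le_nhds (eventually_eq_of_logDeriv_eq_zero
      ((hJ.eventually_mem hx).mono fun s hs => ⟨hf s hs, h s hs⟩)))
    (fun _ _ _ _ _ _ => Eq.trans) (fun _ _ _ _ => Eq.symm) hx hy

theorem mul_inv_eq_of_logDeriv_eq {f k : ℝ → G} {J : Set ℝ} (hJ : IsOpen J) (hJ' : IsPreconnected J)
    (hf : ∀ x ∈ J, MDifferentiableAt 𝓘(ℝ, ℝ) 𝓘(ℝ, E) f x)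
    (hk : ∀ x ∈ J, MDifferentiableAt 𝓘(ℝ, ℝ) 𝓘(ℝ, E) k x)
    (h : ∀ x ∈ J, logDeriv E f x = logDeriv E k x) {x y : ℝ} (hx : x ∈ J) (hy : y ∈ J) :
    f x * (k x)⁻¹ = f y * (k y)⁻¹ := by
  refine eq_of_logDeriv_eq_zero (E := E) (f := fun s => f s * (k s)⁻¹) hJ hJ'
    (fun s hs => mdifferentiableAt_mul_curve (hf s hs) (mdifferentiableAt_inv_curve (hk s hs)))
    (fun s hs => ?_) hx hy
  rw [logDeriv_mul (hf s hs) (mdifferentiableAt_inv_curve (hk s hs)), logDeriv_inv (hk s hs),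
    h s hs, inv_inv, add_neg_cancel]

namespace IsDevelopmentOn

variable {C : ℝ × P → E} {φ κ : ℝ × P → G} {J J' : Set ℝ} {V V' : Set P}

theorem left_mul (h : IsDevelopmentOn C φ J V) {c : P → G}
    (hc : ∀ p ∈ V, ContMDiffAt 𝓘(ℝ, P) 𝓘(ℝ, E) ∞ c p) :
    IsDevelopmentOn C (fun q => c q.2 * φ q) J V where
  __ := h
  contMDiffAt q hq := ContMDiffAt.mul
    (ContMDiffAt.comp q (hc q.2 hq.2) contDiff_snd.contMDiff.contMDiffAt) (h.contMDiffAt q hq)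
  logDeriv_eq q hq := (logDeriv_const_mul _ (c q.2) q.1).trans (h.logDeriv_eq q hq)

theorem eq_of_eq (h : IsDevelopmentOn C φ J V) (h' : IsDevelopmentOn C κ J' V') {p : P}
    (hp : p ∈ V ∩ V') {x y : ℝ} (hx : x ∈ J ∩ J') (hy : y ∈ J ∩ J') (heq : φ (y, p) = κ (y, p)) :
    φ (x, p) = κ (x, p) := by
  have hmul := mul_inv_eq_of_logDeriv_eq (E := E) (f := fun x => φ (x, p))
    (k := fun x => κ (x, p)) (h.isOpen_fst.inter h'.isOpen_fst)
    (h.isPreconnected_fst.ordConnected.inter h'.isPreconnected_fst.ordConnected).isPreconnected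
    (fun s hs => h.mdifferentiableAt_fst hs.1 hp.1) (fun s hs => h'.mdifferentiableAt_fst hs.2 hp.2)
    (fun s hs => (h.logDeriv_eq (s, p) ⟨hs.1, hp.1⟩).trans
      (h'.logDeriv_eq (s, p) ⟨hs.2, hp.2⟩).symm) hx hy
  rwa [heq, mul_inv_cancel, mul_inv_eq_one] at hmul

theorem exists_union (h : IsDevelopmentOn C φ J V) (h' : IsDevelopmentOn C κ J' V') {y : ℝ}
    (hy : y ∈ J) (hy' : y ∈ J') :
    ∃ Φ : ℝ × P → G, IsDevelopmentOn C Φ (J ∪ J') (V ∩ V') := by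
  classical
  have hV := h.isOpen_snd.inter h'.isOpen_snd
  have hφ : IsDevelopmentOn C φ J (V ∩ V') :=
    h.mono h.isOpen_fst h.isPreconnected_fst le_rfl hV Set.inter_subset_left
  have hκ : IsDevelopmentOn C (fun q => φ (y, q.2) * (κ (y, q.2))⁻¹ * κ q) J' (V ∩ V') :=
    (h'.mono h'.isOpen_fst h'.isPreconnected_fst le_rfl hV Set.inter_subset_right).left_mul
      (c := fun p => φ (y, p) * (κ (y, p))⁻¹) fun p hp =>
        (h.contMDiffAt_snd hy hp.1).mul (h'.contMDiffAt_snd hy' hp.2).inv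
  refine ⟨fun q => if q.1 ∈ J then φ q else φ (y, q.2) * (κ (y, q.2))⁻¹ * κ q,
    (hφ.congr fun q hq => if_pos hq.1).union (hκ.congr fun q hq => ?_) hy hy'⟩
  by_cases hJ : q.1 ∈ J
  · exact (if_pos hJ).trans (hφ.eq_of_eq hκ (p := q.2) ⟨hq.2, hq.2⟩ ⟨hJ, hq.1⟩ ⟨hy, hy'⟩ (by simp))
  · exact if_neg hJ

end IsDevelopmentOn

variable {C : ℝ × P → E}

theorem exists_isDevelopmentOn_mem [FiniteDimensional ℝ E] [CompleteSpace P]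
    (hC : ContDiff ℝ ∞ C) (p₀ : P) (x y : ℝ) :
    ∃ (φ : ℝ × P → G) (J : Set ℝ) (V : Set P),
      IsDevelopmentOn C φ J V ∧ x ∈ J ∧ y ∈ J ∧ p₀ ∈ V := by
  refine isPreconnected_univ.induction₂ (fun x y : ℝ => ∃ (φ : ℝ × P → G) (J : Set ℝ) (V : Set P),
    IsDevelopmentOn C φ J V ∧ x ∈ J ∧ y ∈ J ∧ p₀ ∈ V) (fun x _ => ?_) (fun x y z _ _ _ => ?_)
    (fun x y _ _ => ?_) (Set.mem_univ x) (Set.mem_univ y)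
  · obtain ⟨φ, hφ⟩ := exists_local_logDeriv_eq (G := G) hC x p₀
    obtain ⟨r, hr, hball⟩ := Metric.eventually_nhds_iff_ball.1 hφ
    rw [← ball_prod_same] at hball
    have hdev : IsDevelopmentOn C φ (Metric.ball x r) (Metric.ball p₀ r) :=
      ⟨Metric.isOpen_ball, (convex_ball x r).isPreconnected, Metric.isOpen_ball,
        fun q hq => (hball q hq).1, fun q hq => (hball q hq).2⟩
    refine nhdsWithin_le_nhds ((Metric.isOpen_ball.eventually_mem (Metric.mem_ball_self hr)).mono
      fun y hy => ⟨φ, _, _, hdev, Metric.mem_ball_self hr, hy, Metric.mem_ball_self hr⟩)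
  · rintro ⟨φ, J, V, hφ, hx, hy, hp⟩ ⟨κ, J', V', hκ, hy', hz, hp'⟩
    obtain ⟨Φ, hΦ⟩ := hφ.exists_union hκ hy hy'
    exact ⟨Φ, _, _, hΦ, Or.inl hx, Or.inr hz, hp, hp'⟩
  · rintro ⟨φ, J, V, hφ, hx, hy, hp⟩
    exact ⟨φ, J, V, hφ, hy, hx, hp⟩

theorem exists_isDevelopmentOn_univ [FiniteDimensional ℝ E] [CompleteSpace P]
    (hC : ContDiff ℝ ∞ C) :
    ∃ θ : ℝ × P → G, IsDevelopmentOn C θ Set.univ Set.univ ∧ ∀ p, θ (0, p) = 1 := by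
  choose φ J V hφ h0 hx hp using fun q : ℝ × P => exists_isDevelopmentOn_mem (G := G) hC q.2 0 q.1
  let κ (q : ℝ × P) : ℝ × P → G := fun r => (φ q (0, r.2))⁻¹ * φ q r
  have hκ (q : ℝ × P) : IsDevelopmentOn C (κ q) (J q) (V q) :=
    (hφ q).left_mul (c := fun p => (φ q (0, p))⁻¹)
      fun p hp => ((hφ q).contMDiffAt_snd (h0 q) hp).inv
  have hκ0 (q : ℝ × P) (p : P) : κ q (0, p) = 1 := inv_mul_cancel _
  have hdiag (q : ℝ × P) : IsDevelopmentOn C (fun r => κ r r) (J q) (V q) :=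
    (hκ q).congr fun r hr => (hκ r).eq_of_eq (hκ q) ⟨hp r, hr.2⟩ ⟨hx r, hr.1⟩ ⟨h0 r, h0 q⟩
      ((hκ0 r _).trans (hκ0 q _).symm)
  exact ⟨fun r => κ r r, ⟨isOpen_univ, isPreconnected_univ, isOpen_univ,
    fun q _ => (hdiag q).contMDiffAt q ⟨hx q, hp q⟩,
    fun q _ => (hdiag q).logDeriv_eq q ⟨hx q, hp q⟩⟩, fun p => hκ0 _ p⟩

theorem exists_smoothGroup_logDeriv_eq [FiniteDimensional ℝ E] {C : ℝ × ℝ → E}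
    (hC : ContDiff ℝ ∞ C) {θ₀ : ℝ → G} (hθ₀ : ContMDiff 𝓘(ℝ, ℝ) 𝓘(ℝ, E) ∞ θ₀) :
    ∃ θ : ℝ → ℝ → G, SmoothGroup E θ ∧ (∀ t, θ 0 t = θ₀ t) ∧
      ∀ x t, logDeriv E (fun s => θ s t) x = C (x, t) := by
  obtain ⟨κ, hκ, hκ0⟩ := exists_isDevelopmentOn_univ (G := G) hC
  have hθ := hκ.left_mul (c := θ₀) fun t _ => hθ₀ t
  exact ⟨fun x t => θ₀ t * κ (x, t), fun q => hθ.contMDiffAt q ⟨trivial, trivial⟩,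
    fun t => by simp only [hκ0, mul_one], fun x t => hθ.logDeriv_eq (x, t) ⟨trivial, trivial⟩⟩

end

section

/-! ### Existence of parallel framings -/

variable {E : Type*} [NormedAddCommGroup E] [NormedSpace ℝ E]
  {G : Type*} [TopologicalSpace G] [ChartedSpace E G] [Group G] [LieGroup 𝓘(ℝ, E) ∞ G]

instance [FiniteDimensional ℝ E] : FiniteDimensional ℝ (GroupLieAlgebra 𝓘(ℝ, E) G) :=
  inferInstanceAs (FiniteDimensional ℝ E)

theorem contDiff_deriv_fst {F : ℝ × ℝ → E} (hF : ContDiff ℝ ∞ F) :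
    ContDiff ℝ ∞ fun p : ℝ × ℝ => deriv (fun s => F (s, p.2)) p.1 := by
  have h : (fun p : ℝ × ℝ => deriv (fun s => F (s, p.2)) p.1) = fun p => fderiv ℝ F p (1, 0) :=
    funext fun p => (hasDerivAt_comp_prodMk_fst (hF.differentiable (by simp) p)).deriv
  rw [h]
  exact (hF.fderiv_right (m := ∞) (by simp)).clm_apply contDiff_const

/-- The adjoint orbit of a vector of the model space. -/
def adjointOrbit (G : Type*) [TopologicalSpace G] [ChartedSpace E G] [Group G] (v : E) : Set E :=
  Set.range fun k : G => AdE E k v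

/-- The bracket of the Lie algebra written through `adE`. Its type, unlike that of `adE E G v w`,
is the Lie algebra itself, so that nested brackets can be rewritten. -/
def lieE (v w : GroupLieAlgebra 𝓘(ℝ, E) G) : GroupLieAlgebra 𝓘(ℝ, E) G := adE E G v w

theorem lie_eq_lieE (v w : GroupLieAlgebra 𝓘(ℝ, E) G) : ⁅v, w⁆ = lieE v w := (adE_apply v w).symm

section

variable [CompleteSpace E]

theorem adE_skew (v w : E) : adE E G v w = -adE E G w v := by
  have h : ∀ a b : GroupLieAlgebra 𝓘(ℝ, E) G, -⁅b, a⁆ = ⁅a, b⁆ := lie_skew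
  simp only [lie_eq_lieE] at h
  exact (h v w).symm

namespace HermitianSymmetric

variable (S : HermitianSymmetric (GroupLieAlgebra 𝓘(ℝ, E) G))

/-- The element `χ^{-1/2} A`, in the model space. -/
def eE : E := S.e₂

theorem adE_eE_mem {x : E} (hx : x ∈ S.m) : adE E G S.eE x ∈ S.m := by
  have h : ∀ a ∈ S.m, ⁅S.e₂, a⁆ ∈ S.m := fun a => S.lie_e₂_mem_m
  simp only [lie_eq_lieE] at h
  exact h x hx

end HermitianSymmetric

end

namespace HermitianSymmetric

variable [FiniteDimensional ℝ E] (S : HermitianSymmetric (GroupLieAlgebra 𝓘(ℝ, E) G))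

theorem adE_eE_triple (x : E) :
    adE E G S.eE (adE E G S.eE (adE E G S.eE x)) = -(S.chi⁻¹ • adE E G S.eE x) := by
  have h := S.e₂_lie_triple
  simp only [lie_eq_lieE] at h
  exact h x

theorem adE_eE_eE {x : E} (hx : x ∈ S.m) :
    adE E G S.eE (adE E G S.eE x) = -(S.chi⁻¹ • x) := by
  have h : ∀ a ∈ S.m, ⁅S.e₂, ⁅S.e₂, a⁆⁆ = -(S.chi⁻¹ • a) := fun a => S.lie_e₂_lie_e₂
  simp only [lie_eq_lieE] at h
  exact h x hx

theorem adE_triple_of_mem_adjointOrbit {T : E} (hT : T ∈ adjointOrbit G S.eE) (w : E) :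
    adE E G T (adE E G T (adE E G T w)) = -(S.chi⁻¹ • adE E G T w) := by
  obtain ⟨k, rfl⟩ := hT
  obtain ⟨y, rfl⟩ : ∃ y, AdE E k y = w := ⟨AdE E k⁻¹ w, AdE_AdE_inv k w⟩
  simp only [← AdE_adE, adE_eE_triple, map_neg, map_smul]

variable [LieAlgebra.IsKilling ℝ (GroupLieAlgebra 𝓘(ℝ, E) G)]

theorem mem_m_of_linearized_adE {v : E} (hv : ∀ x : E,
    adE E G v (adE E G S.eE (adE E G S.eE x)) + adE E G S.eE (adE E G v (adE E G S.eE x)) +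
      adE E G S.eE (adE E G S.eE (adE E G v x)) = -(S.chi⁻¹ • adE E G v x)) : v ∈ S.m := by
  have h := fun v : GroupLieAlgebra 𝓘(ℝ, E) G => S.mem_m_of_linearized (v := v)
  simp only [lie_eq_lieE] at h
  exact h v hv

variable {T : ℝ → E} {T' : E} {x : ℝ}

theorem AdE_inv_deriv_mem_m (hT : HasDerivAt T T' x) (horb : ∀ s, T s ∈ adjointOrbit G S.eE)
    {k : G} (hk : AdE E k S.eE = T x) : AdE E k⁻¹ T' ∈ S.m := by
  refine S.mem_m_of_linearized_adE fun y => ?_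
  have hA : HasDerivAt (fun s => adE E G (T s)) (adE E G T') x :=
    (adE E G).hasFDerivAt.comp_hasDerivAt x hT
  have hsingle := hA.clm_apply (hasDerivAt_const x (AdE E k y))
  have htriple := hA.clm_apply (hA.clm_apply hsingle)
  -- differentiate `ad(T)³ = -χ⁻¹ ad(T)`, which holds all along the orbit
  simp only [fun s => S.adE_triple_of_mem_adjointOrbit (horb s)] at htriple
  have hderiv := ((hsingle.const_smul S.chi⁻¹).neg).unique htriple
  simp only [map_zero, add_zero, ← hk] at hderiv
  have h := congrArg (AdE E k⁻¹) hderiv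
  simp only [map_add, map_neg, map_smul, AdE_adE, AdE_inv_AdE] at h
  rw [h, add_assoc]

theorem adE_adE_deriv (hT : HasDerivAt T T' x) (horb : ∀ s, T s ∈ adjointOrbit G S.eE) :
    adE E G (T x) (adE E G (T x) T') = -(S.chi⁻¹ • T') := by
  obtain ⟨k, hk⟩ := horb x
  have h := congrArg (AdE E k) (S.adE_eE_eE (S.AdE_inv_deriv_mem_m hT horb hk))
  rwa [AdE_adE, AdE_adE, show AdE E k S.eE = T x from hk, map_neg, map_smul, AdE_AdE_inv] at h

theorem AdE_apply_eq_of_logDeriv {T' : ℝ → E} (hT : ∀ x, HasDerivAt T (T' x) x)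
    (horb : ∀ s, T s ∈ adjointOrbit G S.eE) {θ : ℝ → G}
    (hθ : MDifferentiable 𝓘(ℝ, ℝ) 𝓘(ℝ, E) θ)
    (hθ' : ∀ x, logDeriv E θ x = -(S.chi • adE E G (T x) (T' x))) (x y : ℝ) :
    AdE E (θ x) (T x) = AdE E (θ y) (T y) := by
  have hd : ∀ x, HasDerivAt (fun s => AdE E (θ s) (T s)) 0 x := by
    intro x
    have hcancel : adE E G (logDeriv E θ x) (T x) + T' x = 0 := by
      rw [hθ', map_neg, map_smul, neg_apply, smul_apply, adE_skew (adE E G (T x) (T' x)),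
        S.adE_adE_deriv (hT x) horb, neg_neg, smul_smul, mul_inv_cancel₀ S.chi_pos.ne', one_smul,
        neg_add_cancel]
    simpa only [hcancel, map_zero] using hasDerivAt_AdE_apply (hθ x) (hT x)
  exact is_const_of_deriv_eq_zero (fun x => (hd x).differentiableAt) (fun x => (hd x).deriv) x y

variable {T : ℝ × ℝ → E}

theorem exists_smoothGroup_AdE_eq (hT : ContDiff ℝ ∞ T)
    (horb : ∀ p, T p ∈ adjointOrbit G S.eE) {θ₀ : ℝ → G}
    (hθ₀ : ContMDiff 𝓘(ℝ, ℝ) 𝓘(ℝ, E) ∞ θ₀) :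
    ∃ θ : ℝ → ℝ → G, SmoothGroup E θ ∧
      (∀ x t, AdE E (θ x t) (T (x, t)) = AdE E (θ₀ t) (T (0, t))) ∧
      ∀ x t, logDeriv E (fun s => θ s t) x =
        -(S.chi • adE E G (T (x, t)) (deriv (fun s => T (s, t)) x)) := by
  obtain ⟨θ, hθ, hθ0, hθ'⟩ := exists_smoothGroup_logDeriv_eq
    ((((adE E G).contDiff.comp hT).clm_apply (contDiff_deriv_fst hT)).const_smul S.chi).neg hθ₀
  refine ⟨θ, hθ, fun x t => ?_, hθ'⟩
  rw [← hθ0]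
  exact S.AdE_apply_eq_of_logDeriv (T := fun x => T (x, t)) (hasDerivAt_fst hT · t)
    (fun s => horb _) (hθ.mdifferentiable_fst t) (hθ' · t) x 0

theorem exists_parallel_frame (hT : ContDiff ℝ ∞ T) (horb : ∀ p, T p ∈ adjointOrbit G S.eE) :
    ∃ ψ : ℝ → ℝ → G, SmoothGroup E ψ ∧ (∀ x t, AdE E (ψ x t)⁻¹ (T (x, t)) = S.eE) ∧
      ∀ x t, logDeriv E (fun s => ψ s t) x ∈ S.m := by
  obtain ⟨k₀, hk₀⟩ := horb (0, 0)
  -- transport first along the `t`-axis, then along the lines `t = const`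
  obtain ⟨η, hη, hηT, -⟩ := S.exists_smoothGroup_AdE_eq (T := fun p => T (0, p.1))
    (hT.comp (contDiff_const.prodMk contDiff_fst)) (fun _ => horb _)
    (θ₀ := fun _ : ℝ => k₀⁻¹) contMDiff_const
  obtain ⟨θ, hθ, hθT, hθ'⟩ := S.exists_smoothGroup_AdE_eq hT horb (θ₀ := fun t => η t 0)
    (ContMDiff.comp (f := fun x : ℝ => ((x, 0) : ℝ × ℝ)) hη
      (contDiff_id.prodMk contDiff_const).contMDiff)
  have hadapted : ∀ x t, AdE E (θ x t) (T (x, t)) = S.eE := fun x t => by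
    rw [hθT, hηT t 0, ← hk₀, AdE_inv_AdE]
  refine ⟨fun x t => (θ x t)⁻¹, ContMDiff.inv hθ, fun x t => by rw [inv_inv, hadapted],
    fun x t => ?_⟩
  have hderiv := S.AdE_inv_deriv_mem_m (hasDerivAt_fst hT x t) (fun s => horb _)
    (k := (θ x t)⁻¹) (by rw [← hadapted x t, AdE_inv_AdE])
  rw [inv_inv] at hderiv
  rw [logDeriv_inv (hθ.mdifferentiable_fst t x), hθ', map_neg, neg_neg, map_smul, AdE_adE,
    hadapted]
  exact S.m.smul_mem _ (S.adE_eE_mem hderiv)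

end HermitianSymmetric

end

section

/-! ### The structure equations and the adjoint action -/

theorem deriv_mem_of_forall_mem {W : Type*} [NormedAddCommGroup W] [NormedSpace ℝ W]
    [FiniteDimensional ℝ W] {p : Submodule ℝ W} {f : ℝ → W} (h : ∀ s, f s ∈ p) (x : ℝ) :
    deriv f x ∈ p := by
  have hspan : Submodule.span ℝ (f '' Set.univ) ≤ p :=
    Submodule.span_le.2 (Set.image_subset_iff.2 fun s _ => h s)
  have hderiv := range_deriv_subset_closure_span_image f dense_univ (Set.mem_range_self x)
  exact p.closed_of_finiteDimensional.closure_subset_iff.2 hspan hderiv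

variable {E : Type*} [NormedAddCommGroup E] [NormedSpace ℝ E]
  {G : Type*} [TopologicalSpace G] [ChartedSpace E G] [Group G]
  {F K : ℝ → ℝ → GroupLieAlgebra 𝓘(ℝ, E) G}

theorem dx_add (hF : SmoothLie F) (hK : SmoothLie K) (x t : ℝ) :
    dx (fun x t => F x t + K x t) x t = dx F x t + dx K x t :=
  ((hasDerivAt_fst hF x t).add (hasDerivAt_fst hK x t)).deriv

theorem dx_const (v : GroupLieAlgebra 𝓘(ℝ, E) G) (x t : ℝ) : dx (fun _ _ => v) x t = 0 :=
  deriv_const (F := E) x v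

theorem dt_const (v : GroupLieAlgebra 𝓘(ℝ, E) G) (x t : ℝ) : dt (fun _ _ => v) x t = 0 :=
  deriv_const (F := E) t v

theorem dx_Ad (k : G) (hF : SmoothLie F) (x t : ℝ) :
    dx (fun x t => Ad E k (F x t)) x t = Ad E k (dx F x t) :=
  ((AdE E k).hasFDerivAt.comp_hasDerivAt x (hasDerivAt_fst hF x t)).deriv

theorem dt_Ad (k : G) (hF : SmoothLie F) (x t : ℝ) :
    dt (fun x t => Ad E k (F x t)) x t = Ad E k (dt F x t) :=
  ((AdE E k).hasFDerivAt.comp_hasDerivAt t (hasDerivAt_snd hF x t)).deriv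

theorem SmoothLie.Ad (hF : SmoothLie F) (k : G) : SmoothLie (fun x t => Ad E k (F x t)) :=
  (AdE E k).contDiff.comp hF

section

variable [FiniteDimensional ℝ E] {p : Submodule ℝ (GroupLieAlgebra 𝓘(ℝ, E) G)}

theorem dx_mem (h : ∀ x t, F x t ∈ p) (x t : ℝ) : dx F x t ∈ p :=
  deriv_mem_of_forall_mem (W := E) (p := p) (fun s => h s t) x

theorem dt_mem (h : ∀ x t, F x t ∈ p) (x t : ℝ) : dt F x t ∈ p :=
  deriv_mem_of_forall_mem (W := E) (p := p) (fun s => h x s) t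

end

theorem FrameVars.Smooth.act {V : FrameVars E G} (hV : V.Smooth) (k : G) : (V.act k).Smooth :=
  ⟨hV.q_smooth.Ad k, hV.hpar_smooth.Ad k, hV.hperp_smooth.Ad k, hV.wpar_smooth.Ad k,
    hV.wperp_smooth.Ad k⟩

variable [LieGroup 𝓘(ℝ, E) ∞ G]

theorem Ad_lie (g : G) (v w : GroupLieAlgebra 𝓘(ℝ, E) G) :
    Ad E g ⁅v, w⁆ = ⁅Ad E g v, Ad E g w⁆ := by
  rw [lie_eq_lieE, lie_eq_lieE]
  exact AdE_adE (E := E) g v w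

theorem mem_stabilizer_iff {k : G} {A : GroupLieAlgebra 𝓘(ℝ, E) G} :
    k ∈ stabilizer E A ↔ Ad E k A = A := Iff.rfl

namespace FrameVars

variable (V : FrameVars E G) (x t : ℝ)

/-- The `h`-component of the torsion of the variables `V`: the left side of the first flow
equation. -/
def torsionH : GroupLieAlgebra 𝓘(ℝ, E) G := dx V.hpar x t + ⁅V.q x t, V.hperp x t⁆

/-- The `h`-component of the curvature of the variables `V`: the left side of the third flow
equation. -/
def curvatureH : GroupLieAlgebra 𝓘(ℝ, E) G := dx V.wpar x t + ⁅V.q x t, V.wperp x t⁆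

/-- The `m`-component of the curvature of the variables `V`: the left side of the fourth flow
equation. -/
def curvatureM : GroupLieAlgebra 𝓘(ℝ, E) G :=
  dx V.wperp x t - dt V.q x t + ⁅V.q x t, V.wpar x t⁆

variable {V} (hs : V.Smooth) (k : G)

include hs

theorem torsionH_act : (V.act k).torsionH x t = Ad E k (V.torsionH x t) := by
  simp only [torsionH, act, dx_Ad k hs.hpar_smooth, map_add, Ad_lie]

theorem curvatureH_act : (V.act k).curvatureH x t = Ad E k (V.curvatureH x t) := by
  simp only [curvatureH, act, dx_Ad k hs.wpar_smooth, map_add, Ad_lie]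

theorem curvatureM_act : (V.act k).curvatureM x t = Ad E k (V.curvatureM x t) := by
  simp only [curvatureM, act, dx_Ad k hs.wperp_smooth, dt_Ad k hs.q_smooth, map_add, map_sub,
    Ad_lie]

end FrameVars

variable [CompleteSpace E]

/-- The adjoint action by Lie algebra automorphisms. -/
def AdLieEquiv (g : G) : GroupLieAlgebra 𝓘(ℝ, E) G ≃ₗ⁅ℝ⁆ GroupLieAlgebra 𝓘(ℝ, E) G where
  toFun := Ad E g
  map_add' := map_add _
  map_smul' := map_smul _
  map_lie' := Ad_lie g _ _
  invFun := Ad E g⁻¹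
  left_inv := AdE_inv_AdE (E := E) g
  right_inv := AdE_AdE_inv (E := E) g

theorem affInner_coframe (g : G) (X Y : GroupLieAlgebra 𝓘(ℝ, E) G) :
    affInner (coframe g X) (coframe g Y) = metric X Y := by
  have h := LieAlgebra.killingForm_of_equiv_apply (R := ℝ) (AdLieEquiv (E := E) g⁻¹) X Y
  simp only [affInner, metric, coframe]
  rw [← h]
  rfl

theorem Ad_eq_zero_iff {k : G} {a : GroupLieAlgebra 𝓘(ℝ, E) G} : Ad E k a = 0 ↔ a = 0 :=
  (AdLieEquiv (E := E) k).toLinearEquiv.map_eq_zero_iff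

variable (S : HermitianSymmetric (GroupLieAlgebra 𝓘(ℝ, E) G))

section Stabilizer

variable {k : G} (hk : k ∈ stabilizer E S.A) {a : GroupLieAlgebra 𝓘(ℝ, E) G}

include hk

theorem Ad_mem_h (ha : a ∈ S.h) : Ad E k a ∈ S.h := by
  rw [S.centralizer_A] at ha ⊢
  have h := Ad_lie k S.A a
  rwa [ha, map_zero, mem_stabilizer_iff.1 hk, eq_comm] at h

theorem Ad_mem_m (ha : a ∈ S.m) : Ad E k a ∈ S.m := by
  have h := congrArg (Ad E k) (S.ad_A_sq a ha)
  rw [Ad_lie, Ad_lie, mem_stabilizer_iff.1 hk, S.lie_A_lie_A, map_neg, neg_inj] at h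
  exact h ▸ S.projM_mem _

theorem FrameVars.Valued.act {V : FrameVars E G} (hV : V.Valued S) : (V.act k).Valued S :=
  ⟨fun x t => Ad_mem_m S hk (hV.q_mem x t), fun x t => Ad_mem_h S hk (hV.hpar_mem x t),
    fun x t => Ad_mem_m S hk (hV.hperp_mem x t), fun x t => Ad_mem_h S hk (hV.wpar_mem x t),
    fun x t => Ad_mem_m S hk (hV.wperp_mem x t)⟩

end Stabilizer

namespace FrameVars

variable (V : FrameVars E G) (x t : ℝ)

/-- The `m`-component of the torsion of the variables `V`: the left side of the second flow
equation. -/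
def torsionM : GroupLieAlgebra 𝓘(ℝ, E) G :=
  dx V.hperp x t + ⁅V.q x t, V.hpar x t⁆ + (√S.chi)⁻¹ • ⁅S.A, V.wperp x t⁆

variable {V}

theorem flowEqs_iff : V.FlowEqs S ↔ ∀ x t,
    (V.torsionH x t = 0 ∧ V.torsionM S x t = 0) ∧ V.curvatureH x t = 0 ∧ V.curvatureM x t = 0 :=
  ⟨fun ⟨hpar, hperp, wpar, wperp⟩ x t => ⟨⟨hpar x t, hperp x t⟩, wpar x t, wperp x t⟩,
    fun h => ⟨fun x t => (h x t).1.1, fun x t => (h x t).1.2, fun x t => (h x t).2.1,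
      fun x t => (h x t).2.2⟩⟩

section Act

variable (hs : V.Smooth) {k : G} (hk : k ∈ stabilizer E S.A)

include hs hk

theorem torsionM_act : (V.act k).torsionM S x t = Ad E k (V.torsionM S x t) := by
  simp only [torsionM, act, dx_Ad k hs.hperp_smooth, map_add, map_smul, Ad_lie,
    mem_stabilizer_iff.1 hk]

theorem flowEqs_act_iff : V.FlowEqs S ↔ (V.act k).FlowEqs S := by
  simp only [flowEqs_iff, torsionH_act _ _ hs, torsionM_act S _ _ hs hk, curvatureH_act _ _ hs,
    curvatureM_act _ _ hs, Ad_eq_zero_iff]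

end Act

section Valued

variable [FiniteDimensional ℝ E] (hV : V.Valued S)

include hV

theorem torsionH_mem : V.torsionH x t ∈ S.h :=
  S.h.add_mem (dx_mem (p := S.h.toSubmodule) hV.hpar_mem x t)
    (S.lie_m_m _ (hV.q_mem x t) _ (hV.hperp_mem x t))

theorem torsionM_mem : V.torsionM S x t ∈ S.m :=
  S.m.add_mem (S.m.add_mem (dx_mem hV.hperp_mem x t)
    (S.lie_m_h (hV.q_mem x t) (hV.hpar_mem x t)))
    (S.m.smul_mem _ (S.lie_A_mem_m (hV.wperp_mem x t)))

theorem curvatureH_mem : V.curvatureH x t ∈ S.h :=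
  S.h.add_mem (dx_mem (p := S.h.toSubmodule) hV.wpar_mem x t)
    (S.lie_m_m _ (hV.q_mem x t) _ (hV.wperp_mem x t))

theorem curvatureM_mem : V.curvatureM x t ∈ S.m :=
  S.m.add_mem (S.m.sub_mem (dx_mem hV.wperp_mem x t) (dt_mem hV.q_mem x t))
    (S.lie_m_h (hV.q_mem x t) (hV.wpar_mem x t))

end Valued

theorem torsion_eq (hV : V.Valued S) (hs : V.Smooth) :
    dxAff (fun x t => (0, V.hpar x t + V.hperp x t)) x t - dtAff (fun _ _ => S.e) x t
      + affBracket (V.q x t, 0) (0, V.hpar x t + V.hperp x t)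
      - affBracket (V.wpar x t + V.wperp x t, 0) S.e = (0, V.torsionH x t + V.torsionM S x t) := by
  have hpar : ⁅V.wpar x t, S.e₂⁆ = 0 := by
    rw [← lie_skew, S.lie_e₂_of_mem_h (hV.wpar_mem x t), neg_zero]
  have hperp : ⁅V.wperp x t, S.e₂⁆ = -((√S.chi)⁻¹ • ⁅S.A, V.wperp x t⁆) := by
    rw [← lie_skew, HermitianSymmetric.e₂, smul_lie]
  simp only [dxAff, dtAff, affBracket, torsionH, torsionM, S.e_eq, dx_const, dt_const,
    dx_add hs.hpar_smooth hs.hperp_smooth, lie_zero, lie_add, add_lie, hpar, hperp,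
    Prod.mk_sub_mk, Prod.mk_add_mk, sub_zero, add_zero, zero_add, Prod.mk.injEq, true_and]
  abel

theorem curvature_eq (hs : V.Smooth) :
    dxAff (fun x t => (V.wpar x t + V.wperp x t, 0)) x t - dtAff (fun x t => (V.q x t, 0)) x t
      + affBracket (V.q x t, 0) (V.wpar x t + V.wperp x t, 0) =
      (V.curvatureH x t + V.curvatureM x t, 0) := by
  simp only [dxAff, dtAff, affBracket, curvatureH, curvatureM, dx_const, dt_const,
    dx_add hs.wpar_smooth hs.wperp_smooth, lie_zero, zero_lie, lie_add,
    Prod.mk_sub_mk, Prod.mk_add_mk, sub_zero, add_zero, Prod.mk.injEq, and_true]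
  abel

theorem structureEqs_iff_flowEqs [FiniteDimensional ℝ E] (hV : V.Valued S) (hs : V.Smooth) :
    StructureEqs (fun _ _ => S.e) (fun x t => (0, V.hpar x t + V.hperp x t))
      (fun x t => (V.q x t, 0)) (fun x t => (V.wpar x t + V.wperp x t, 0)) ↔ V.FlowEqs S := by
  simp only [StructureEqs, torsion_eq S _ _ hV hs, curvature_eq _ _ hs, Prod.mk_eq_zero, true_and,
    and_true, S.add_eq_zero_iff (torsionH_mem S _ _ hV) (torsionM_mem S _ _ hV),
    S.add_eq_zero_iff (curvatureH_mem S _ _ hV) (curvatureM_mem S _ _ hV), flowEqs_iff,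
    forall_and]

end FrameVars

end

section

/-! ### The structure equations of a framing -/

variable {E : Type*} [NormedAddCommGroup E] [NormedSpace ℝ E]
  {G : Type*} [TopologicalSpace G] [ChartedSpace E G] [Group G] [LieGroup 𝓘(ℝ, E) ∞ G]
  {γ : ℝ → ℝ → Aff E G} {ψ : ℝ → ℝ → G}

theorem hasDerivAt_AdE_inv_apply {f : ℝ → G} {F : ℝ → E} {x : ℝ} {F' : E}
    (hf : MDifferentiableAt 𝓘(ℝ, ℝ) 𝓘(ℝ, E) f x) (hF : HasDerivAt F F' x) :
    HasDerivAt (fun s => AdE E (f s)⁻¹ (F s))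
      (AdE E (f x)⁻¹ F' - adE E G (logDeriv E f x) (AdE E (f x)⁻¹ (F x))) x := by
  have h := hasDerivAt_AdE_apply (mdifferentiableAt_inv_curve hf) hF
  rwa [logDeriv_inv hf, map_add, AdE_adE, map_neg, AdE_inv_AdE, map_neg, neg_apply,
    neg_add_eq_sub] at h

theorem SmoothFlow.smoothLie_tangentX (hγ : SmoothFlow γ) : SmoothLie (tangentX γ) :=
  contDiff_deriv_fst hγ

theorem SmoothFlow.smoothLie_tangentT (hγ : SmoothFlow γ) : SmoothLie (tangentT γ) :=
  (contDiff_deriv_fst (ContDiff.comp (E := ℝ × ℝ) hγ (contDiff_snd.prodMk contDiff_fst))).comp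
    (contDiff_snd.prodMk contDiff_fst)

theorem SmoothFlow.dx_tangentT (hγ : SmoothFlow γ) (x t : ℝ) :
    dx (tangentT γ) x t = dt (tangentX γ) x t := by
  have hΓ : ContDiff ℝ ∞ (F := E) fun p : ℝ × ℝ => Aff.chart E G (γ p.1 p.2) := hγ
  exact deriv_deriv_comm (hΓ.contDiffAt.of_le ENat.LEInfty.out)

variable (hψ : SmoothGroup E ψ) (x t : ℝ)

include hψ

theorem SmoothGroup.torsion_eq_zero (hγ : SmoothFlow γ) :
    dx (fun x t => Ad E (ψ x t)⁻¹ (tangentT γ x t)) x t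
      - dt (fun x t => Ad E (ψ x t)⁻¹ (tangentX γ x t)) x t
      + ⁅logDx E ψ x t, Ad E (ψ x t)⁻¹ (tangentT γ x t)⁆
      - ⁅logDt E ψ x t, Ad E (ψ x t)⁻¹ (tangentX γ x t)⁆ = 0 := by
  have hx : dx (fun x t => Ad E (ψ x t)⁻¹ (tangentT γ x t)) x t =
      Ad E (ψ x t)⁻¹ (dx (tangentT γ) x t) -
        ⁅logDx E ψ x t, Ad E (ψ x t)⁻¹ (tangentT γ x t)⁆ := by
    rw [lie_eq_lieE]
    exact (hasDerivAt_AdE_inv_apply (hψ.mdifferentiable_fst t x)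
      (hasDerivAt_fst hγ.smoothLie_tangentT x t)).deriv
  have ht : dt (fun x t => Ad E (ψ x t)⁻¹ (tangentX γ x t)) x t =
      Ad E (ψ x t)⁻¹ (dt (tangentX γ) x t) -
        ⁅logDt E ψ x t, Ad E (ψ x t)⁻¹ (tangentX γ x t)⁆ := by
    rw [lie_eq_lieE]
    exact (hasDerivAt_AdE_inv_apply (hψ.swap.mdifferentiable_fst x t)
      (hasDerivAt_snd hγ.smoothLie_tangentX x t)).deriv
  rw [hx, ht, hγ.dx_tangentT]
  abel

theorem SmoothGroup.curvature_eq_zero :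
    dx (logDt E ψ) x t - dt (logDx E ψ) x t + ⁅logDx E ψ x t, logDt E ψ x t⁆ = 0 := by
  rw [lie_eq_lieE]
  exact maurerCartan hψ x t

variable [CompleteSpace E]

theorem SmoothGroup.structureEqs (hγ : SmoothFlow γ) :
    StructureEqs (fun x t => coframe (ψ x t) (tangentX γ x t))
      (fun x t => coframe (ψ x t) (tangentT γ x t)) (connX E ψ) (connT E ψ) := by
  refine ⟨fun x t => Prod.ext ?_ ?_, fun x t => Prod.ext ?_ ?_⟩
  · simp [dxAff, dtAff, affBracket, coframe, connX, connT, dx_const, dt_const]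
  · simpa [dxAff, dtAff, affBracket, coframe, connX, connT] using hψ.torsion_eq_zero x t hγ
  · simpa [dxAff, dtAff, affBracket, connX, connT] using hψ.curvature_eq_zero x t
  · simp [dxAff, dtAff, affBracket, connX, connT, dx_const, dt_const]

end

section

/-! ### Parallel framings and their equivalence group -/

variable {E : Type*} [NormedAddCommGroup E] [NormedSpace ℝ E]
  {G : Type*} [TopologicalSpace G] [ChartedSpace E G] [Group G]

theorem logDeriv_const (k : G) (x : ℝ) : logDeriv E (fun _ => k) x = 0 :=
  DFunLike.congr_fun mfderiv_const (1 : ℝ)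

theorem logDx_eq_zero_of_forall_eq {g : ℝ → ℝ → G} (h : ∀ x x' t, g x t = g x' t) (x t : ℝ) :
    logDx E g x t = 0 := by
  have hconst : (fun s => g s t) = fun _ => g 0 t := funext fun s => h s 0 t
  have hlog : logDeriv E (fun s => g s t) x = 0 := by rw [hconst, logDeriv_const]
  exact hlog

variable [LieGroup 𝓘(ℝ, E) ∞ G]

theorem logDeriv_mul_const {f : ℝ → G} {x : ℝ} (hf : MDifferentiableAt 𝓘(ℝ, ℝ) 𝓘(ℝ, E) f x)
    (k : G) : logDeriv E (fun s => f s * k) x = AdE E k⁻¹ (logDeriv E f x) := by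
  rw [logDeriv_mul hf mdifferentiableAt_const, logDeriv_const, add_zero]

theorem logDeriv_comp_add_const {f : ℝ → G} (hf : MDifferentiable 𝓘(ℝ, ℝ) 𝓘(ℝ, E) f) (l x : ℝ) :
    logDeriv E (fun s => f (s + l)) x = logDeriv E f (x + l) := by
  have hshift : HasMFDerivAt 𝓘(ℝ, ℝ) 𝓘(ℝ, ℝ) (fun s : ℝ => s + l) x
      (ContinuousLinearMap.id ℝ ℝ) := ((hasFDerivAt_id x).add_const l).hasMFDerivAt
  have hcomp := (mdifferentiableAt_const_mul (hf (x + l)) (f (x + l))⁻¹).hasMFDerivAt.comp x hshift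
  exact DFunLike.congr_fun hcomp.mfderiv (1 : ℝ)

theorem logDx_mul {ψ g : ℝ → ℝ → G} (hψ : SmoothGroup E ψ) (hg : SmoothGroup E g) (x t : ℝ) :
    logDx E (fun x t => ψ x t * g x t) x t = Ad E (g x t)⁻¹ (logDx E ψ x t) + logDx E g x t :=
  logDeriv_mul (hψ.mdifferentiable_fst t x) (hg.mdifferentiable_fst t x)

theorem FrameVars.Represents.act {γ : ℝ → ℝ → Aff E G} {ψ : ℝ → ℝ → G} {V : FrameVars E G}
    (hV : V.Represents γ ψ) (hψ : SmoothGroup E ψ) (k : G) :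
    (V.act k⁻¹).Represents γ (fun x t => ψ x t * k) where
  connX_eq x t := Prod.ext ((logDeriv_mul_const (hψ.mdifferentiable_fst t x) k).trans
    (congrArg (AdE E k⁻¹) (congrArg Prod.fst (hV.connX_eq x t)))) rfl
  coframeT_eq x t := by
    have h : Ad E (ψ x t)⁻¹ (tangentT γ x t) = V.hpar x t + V.hperp x t :=
      congrArg Prod.snd (hV.coframeT_eq x t)
    simp only [coframe, FrameVars.act, mul_inv_rev, Ad_mul, ← map_add, ← h,
      ContinuousLinearMap.comp_apply]
  connT_eq x t := by
    simp only [FrameVars.act, ← map_add]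
    exact Prod.ext ((logDeriv_mul_const (hψ.swap.mdifferentiable_fst x t) k).trans
      (congrArg (AdE E k⁻¹) (congrArg Prod.fst (hV.connT_eq x t)))) rfl

section

variable [CompleteSpace E] (S : HermitianSymmetric (GroupLieAlgebra 𝓘(ℝ, E) G))

theorem coframe_eq_e_iff (g : G) (X : GroupLieAlgebra 𝓘(ℝ, E) G) :
    coframe g X = S.e ↔ Ad E g⁻¹ X = S.e₂ := by
  rw [S.e_eq, coframe, Prod.mk.injEq]
  exact and_iff_right rfl

theorem logDeriv_mem_h {f : ℝ → G} {x : ℝ}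
    (hf : MDifferentiableAt 𝓘(ℝ, ℝ) 𝓘(ℝ, E) f x) (hstab : ∀ s, f s ∈ stabilizer E S.A) :
    logDeriv E f x ∈ S.h := by
  have hfix : ∀ a : E, (∀ s, AdE E (f s) a = a) → adE E G a (logDeriv E f x) = 0 := by
    intro a ha
    have hderiv := hasDerivAt_AdE_apply hf (hasDerivAt_const x a)
    simp only [ha] at hderiv
    have hzero := congrArg (AdE E (f x)⁻¹) (hderiv.unique (hasDerivAt_const x a))
    rwa [AdE_inv_AdE, add_zero, map_zero, adE_skew, neg_eq_zero] at hzero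
  exact (S.centralizer_A _).2 ((lie_eq_lieE _ _).trans (hfix S.A hstab))

/-- The variables of a framing: the components of its connection and coframe in `h` and `m`. -/
def FrameVars.ofFraming (γ : ℝ → ℝ → Aff E G) (ψ : ℝ → ℝ → G) : FrameVars E G where
  q := logDx E ψ
  hpar x t := S.projH (Ad E (ψ x t)⁻¹ (tangentT γ x t))
  hperp x t := S.projM (Ad E (ψ x t)⁻¹ (tangentT γ x t))
  wpar x t := S.projH (logDt E ψ x t)
  wperp x t := S.projM (logDt E ψ x t)

variable {γ : ℝ → ℝ → Aff E G} {ψ : ℝ → ℝ → G}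

theorem FrameVars.represents_ofFraming : (ofFraming S γ ψ).Represents γ ψ where
  connX_eq _ _ := rfl
  coframeT_eq x t := by simp only [ofFraming, S.projH_add_projM, coframe]
  connT_eq x t := by simp only [ofFraming, S.projH_add_projM, connT]

theorem FrameVars.eq_ofFraming {V : FrameVars E G} (hV : V.Valued S) (hr : V.Represents γ ψ) :
    V = ofFraming S γ ψ := by
  have hproj : ∀ {a b c}, a ∈ S.h → b ∈ S.m → c = a + b → a = S.projH c ∧ b = S.projM c := by
    intro a b c ha hb hab
    rw [hab, map_add, map_add, S.projH_of_mem_h ha, S.projH_of_mem_m hb, S.projM_of_mem_h ha,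
      S.projM_of_mem_m hb, add_zero, zero_add]
    exact ⟨rfl, rfl⟩
  have hcoframe := fun x t => hproj (hV.hpar_mem x t) (hV.hperp_mem x t)
    (congrArg Prod.snd (hr.coframeT_eq x t))
  have hconn := fun x t => hproj (hV.wpar_mem x t) (hV.wperp_mem x t)
    (congrArg Prod.fst (hr.connT_eq x t))
  exact FrameVars.ext (funext₂ fun x t => (congrArg Prod.fst (hr.connX_eq x t)).symm)
    (funext₂ fun x t => (hcoframe x t).1) (funext₂ fun x t => (hcoframe x t).2)
    (funext₂ fun x t => (hconn x t).1) (funext₂ fun x t => (hconn x t).2)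

end

variable [FiniteDimensional ℝ E] (S : HermitianSymmetric (GroupLieAlgebra 𝓘(ℝ, E) G))

theorem metric_self_of_coframe_eq_e {g : G} {X : GroupLieAlgebra 𝓘(ℝ, E) G}
    (h : coframe g X = S.e) : metric X X = 1 := by
  rw [← affInner_coframe g, h, S.affInner_e]

theorem mem_stabilizer_iff_e₂ {k : G} : k ∈ stabilizer E S.A ↔ Ad E k S.e₂ = S.e₂ := by
  rw [mem_stabilizer_iff, HermitianSymmetric.e₂, map_smul]
  exact (smul_right_injective _ S.inv_sqrt_chi_pos.ne').eq_iff.symm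

theorem coframe_mul_eq_e_iff {g : G} {X : GroupLieAlgebra 𝓘(ℝ, E) G} (h : coframe g X = S.e)
    (k : G) : coframe (g * k) X = S.e ↔ k ∈ stabilizer E S.A := by
  rw [coframe_eq_e_iff, mul_inv_rev, Ad_mul, ContinuousLinearMap.comp_apply,
    (coframe_eq_e_iff S _ _).1 h, ← mem_stabilizer_iff_e₂, inv_mem_iff]

theorem SmoothLie.projM {F : ℝ → ℝ → GroupLieAlgebra 𝓘(ℝ, E) G} (hF : SmoothLie F) :
    SmoothLie (fun x t => S.projM (F x t)) :=
  (LinearMap.toContinuousLinearMap (show E →ₗ[ℝ] E from S.projM)).contDiff.comp hF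

theorem SmoothLie.projH {F : ℝ → ℝ → GroupLieAlgebra 𝓘(ℝ, E) G} (hF : SmoothLie F) :
    SmoothLie (fun x t => S.projH (F x t)) :=
  (LinearMap.toContinuousLinearMap (show E →ₗ[ℝ] E from S.projH)).contDiff.comp hF

variable {γ : ℝ → ℝ → Aff E G} {ψ : ℝ → ℝ → G}

theorem FrameVars.smooth_ofFraming (hγ : SmoothFlow γ) (hψ : SmoothGroup E ψ) :
    (ofFraming S γ ψ).Smooth := by
  have hAd : ContDiff ℝ ∞ fun p : ℝ × ℝ => AdE E (ψ p.1 p.2)⁻¹ :=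
    contMDiff_iff_contDiff.1 (contMDiff_AdE.comp (ContMDiff.inv hψ))
  have hcoframe : SmoothLie (fun x t => Ad E (ψ x t)⁻¹ (tangentT γ x t)) :=
    hAd.clm_apply hγ.smoothLie_tangentT
  have hconn : SmoothLie (logDt E ψ) := contDiff_logDeriv_snd hψ
  exact ⟨contDiff_logDeriv_fst hψ, hcoframe.projH S, hcoframe.projM S, hconn.projH S,
    hconn.projM S⟩

variable [LieAlgebra.IsKilling ℝ (GroupLieAlgebra 𝓘(ℝ, E) G)]

theorem connX_mem_hAffPerp_iff (x t : ℝ) :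
    connX E ψ x t ∈ hAffPerp S.e ↔ logDx E ψ x t ∈ S.m := by
  rw [S.mem_hAffPerp_iff]
  exact and_iff_right rfl

theorem exists_isGParallelFraming (hγ : SmoothFlow γ)
    (h : ∀ x t, ∃ g : G, coframe g (tangentX γ x t) = S.e) :
    ∃ ψ : ℝ → ℝ → G, IsGParallelFraming S γ ψ := by
  have horb : ∀ p : ℝ × ℝ, tangentX γ p.1 p.2 ∈ adjointOrbit G S.eE := by
    intro p
    obtain ⟨g, hg⟩ := h p.1 p.2
    rw [coframe_eq_e_iff] at hg
    exact ⟨g, (congrArg (AdE E g) hg.symm).trans (AdE_AdE_inv (E := E) g _)⟩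
  obtain ⟨ψ, hsmooth, hadapted, hm⟩ := S.exists_parallel_frame hγ.smoothLie_tangentX horb
  exact ⟨ψ, hsmooth, fun x t => (coframe_eq_e_iff S _ _).2 (hadapted x t),
    fun x t => (connX_mem_hAffPerp_iff S x t).2 (hm x t)⟩

namespace IsGParallelFraming

variable {S} (h : IsGParallelFraming S γ ψ)

include h

theorem logDx_mem (x t : ℝ) : logDx E ψ x t ∈ S.m :=
  (connX_mem_hAffPerp_iff S x t).1 (h.parallel x t)

theorem valued_ofFraming : (FrameVars.ofFraming S γ ψ).Valued S :=
  ⟨h.logDx_mem, fun _ _ => S.projH_mem _, fun _ _ => S.projM_mem _, fun _ _ => S.projH_mem _,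
    fun _ _ => S.projM_mem _⟩

theorem flowEqs_ofFraming (hγ : SmoothFlow γ) : (FrameVars.ofFraming S γ ψ).FlowEqs S := by
  rw [← FrameVars.structureEqs_iff_flowEqs S h.valued_ofFraming
    (FrameVars.smooth_ofFraming S hγ h.smooth)]
  have hstr := h.smooth.structureEqs hγ
  have hr : (FrameVars.ofFraming S γ ψ).Represents γ ψ := FrameVars.represents_ofFraming S
  rwa [funext₂ h.adapted, funext₂ hr.coframeT_eq, funext₂ hr.connX_eq, funext₂ hr.connT_eq]
    at hstr

theorem logDx_mul_mem_m_iff {g : ℝ → ℝ → G} (hg : SmoothGroup E g)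
    (hstab : ∀ x t, g x t ∈ stabilizer E S.A) (x t : ℝ) :
    logDx E (fun x t => ψ x t * g x t) x t ∈ S.m ↔ logDx E g x t = 0 := by
  rw [logDx_mul h.smooth hg,
    S.m.add_mem_iff_right (Ad_mem_m S (inv_mem (hstab x t)) (h.logDx_mem x t))]
  exact ⟨S.eq_zero_of_mem (logDeriv_mem_h S (hg.mdifferentiable_fst t x) (hstab · t)),
    fun h0 => h0 ▸ S.m.zero_mem⟩

theorem mul_iff {g : ℝ → ℝ → G} (hg : SmoothGroup E g) :
    IsGParallelFraming S γ (fun x t => ψ x t * g x t) ↔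
      (∀ x t, g x t ∈ stabilizer E S.A) ∧ ∀ x x' t, g x t = g x' t := by
  constructor
  · intro h'
    have hstab := fun x t => (coframe_mul_eq_e_iff S (h.adapted x t) _).1 (h'.adapted x t)
    have hzero := fun x t => (h.logDx_mul_mem_m_iff hg hstab x t).1 (h'.logDx_mem x t)
    exact ⟨hstab, fun x x' t => eq_of_logDeriv_eq_zero isOpen_univ isPreconnected_univ
      (fun x _ => hg.mdifferentiable_fst t x) (fun x _ => hzero x t) (Set.mem_univ x)
      (Set.mem_univ x')⟩
  · rintro ⟨hstab, hconst⟩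
    exact ⟨ContMDiff.mul h.smooth hg,
      fun x t => (coframe_mul_eq_e_iff S (h.adapted x t) _).2 (hstab x t),
      fun x t => (connX_mem_hAffPerp_iff S x t).2 ((h.logDx_mul_mem_m_iff hg hstab x t).2
        (logDx_eq_zero_of_forall_eq hconst x t))⟩

theorem mul_const_iff (k : G) :
    IsGParallelFraming S γ (fun x t => ψ x t * k) ↔ k ∈ stabilizer E S.A := by
  rw [h.mul_iff (g := fun _ _ => k) contMDiff_const]
  exact ⟨fun hk => hk.1 0 0, fun hk => ⟨fun _ _ => hk, fun _ _ _ => rfl⟩⟩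

theorem comp_add_const {l : ℝ} (hl : ∀ x t, γ (x + l) t = γ x t) :
    IsGParallelFraming S γ (fun x t => ψ (x + l) t) where
  smooth := ContMDiff.comp (f := fun p : ℝ × ℝ => (p.1 + l, p.2)) h.smooth
    ((contDiff_fst.add contDiff_const).prodMk contDiff_snd).contMDiff
  adapted x t := by
    have hγ := deriv_comp_add_const (F := E) (fun s => Aff.chart E G (γ s t)) l x
    simp only [hl] at hγ
    rw [← h.adapted (x + l) t]
    exact congrArg (coframe (ψ (x + l) t)) hγ
  parallel x t := by
    have hlog : logDx E (fun x t => ψ (x + l) t) x t = logDx E ψ (x + l) t :=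
      logDeriv_comp_add_const (h.smooth.mdifferentiable_fst t) l x
    rw [connX_mem_hAffPerp_iff, hlog]
    exact h.logDx_mem (x + l) t

theorem exists_period {l : ℝ} (hl : ∀ x t, γ (x + l) t = γ x t) (t : ℝ) :
    ∃ k ∈ stabilizer E S.A, ∀ x, ψ (x + l) t = ψ x t * k := by
  have hshift := h.comp_add_const hl
  obtain ⟨hstab, hconst⟩ := (h.mul_iff (g := fun x t => (ψ x t)⁻¹ * ψ (x + l) t)
    (ContMDiff.mul (ContMDiff.inv h.smooth) hshift.smooth)).1
    (by simpa only [mul_inv_cancel_left] using hshift)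
  exact ⟨_, hstab 0 t, fun x => by rw [← hconst x 0 t, mul_inv_cancel_left]⟩

end IsGParallelFraming

end

end AffHermitian

end

open AffHermitian in
theorem mainTheorem12_general
    {E : Type*} [NormedAddCommGroup E] [NormedSpace ℝ E] [FiniteDimensional ℝ E]
    {G : Type*} [TopologicalSpace G] [ChartedSpace E G] [Group G]
    [LieGroup 𝓘(ℝ, E) ∞ G] [LieAlgebra.IsSemisimple ℝ (GroupLieAlgebra 𝓘(ℝ, E) G)]
    (S : HermitianSymmetric (GroupLieAlgebra 𝓘(ℝ, E) G)) :
    S.chi = Module.finrank ℝ S.m ∧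
    (∀ (g : G) (X Y : GroupLieAlgebra 𝓘(ℝ, E) G),
      affInner (coframe g X) (coframe g Y) =
        metric X Y) ∧
    (∀ γ : ℝ → ℝ → Aff E G, SmoothFlow γ →
      (∀ x t, ∃ g : G, coframe g (tangentX γ x t) = S.e) →
      (∀ x t, metric (tangentX γ x t) (tangentX γ x t) = 1) ∧
      (∃ ψ : ℝ → ℝ → G, IsGParallelFraming S γ ψ) ∧
      (∀ ψ : ℝ → ℝ → G, IsGParallelFraming S γ ψ →
        (∃! V : FrameVars E G, V.Valued S ∧ V.Represents γ ψ) ∧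
        StructureEqs
          (fun x t => coframe (ψ x t) (tangentX γ x t))
          (fun x t => coframe (ψ x t) (tangentT γ x t))
          (connX E ψ) (connT E ψ) ∧
        (∀ V : FrameVars E G, V.Valued S → V.Represents γ ψ →
          V.Smooth ∧ V.FlowEqs S) ∧
        {k : G | IsGParallelFraming S γ (fun x t => ψ x t * k)} =
          stabilizer E S.A ∧
        (∀ g : ℝ → ℝ → G, SmoothGroup E g →
          (IsGParallelFraming S γ (fun x t => ψ x t * g x t) ↔
            (∀ x t, g x t ∈ stabilizer E S.A) ∧ ∀ x x' t, g x t = g x' t)) ∧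
        (∀ k ∈ stabilizer E S.A, ∀ V : FrameVars E G,
          V.Represents γ ψ → (V.act k⁻¹).Represents γ (fun x t => ψ x t * k)) ∧
        (∀ l : ℝ, (∀ x t, γ (x + l) t = γ x t) →
          ∀ t, ∃ k ∈ stabilizer E S.A, ∀ x, ψ (x + l) t = ψ x t * k))) ∧
    (∀ V : FrameVars E G, V.Valued S → V.Smooth →
      (StructureEqs (fun _ _ => S.e) (fun x t => (0, V.hpar x t + V.hperp x t))
          (fun x t => (V.q x t, 0)) (fun x t => (V.wpar x t + V.wperp x t, 0)) ↔
        V.FlowEqs S)) ∧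
    (∀ k ∈ stabilizer E S.A, ∀ V : FrameVars E G, V.Valued S →
      V.Smooth → (V.act k).Valued S ∧ (V.act k).Smooth ∧ (V.FlowEqs S ↔ (V.act k).FlowEqs S)) := by
  refine ⟨S.chi_eq_finrank, affInner_coframe, fun γ hγ hcl => ⟨fun x t => ?_,
    exists_isGParallelFraming S hγ hcl, fun ψ hψ => ?_⟩,
    fun V hV hs => FrameVars.structureEqs_iff_flowEqs S hV hs,
    fun k hk V hV hs => ⟨hV.act S hk, hs.act k, FrameVars.flowEqs_act_iff S hs hk⟩⟩
  · obtain ⟨g, hg⟩ := hcl x t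
    exact metric_self_of_coframe_eq_e S hg
  · refine ⟨⟨FrameVars.ofFraming S γ ψ, ⟨hψ.valued_ofFraming, FrameVars.represents_ofFraming S⟩,
        fun V hV => FrameVars.eq_ofFraming S hV.1 hV.2⟩,
      hψ.smooth.structureEqs hγ, fun V hV hr => ?_, Set.ext hψ.mul_const_iff,
      fun g hg => hψ.mul_iff hg, fun k _ V hr => hr.act hψ.smooth k,
      fun l hl => hψ.exists_period hl⟩
    rw [FrameVars.eq_ofFraming S hV hr]
    exact ⟨FrameVars.smooth_ofFraming S hγ hψ.smooth, hψ.flowEqs_ofFraming hγ⟩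

theorem mainTheorem12
    {E : Type*} [NormedAddCommGroup E] [NormedSpace ℝ E] [FiniteDimensional ℝ E] [CompleteSpace E]
    {G : Type*} [TopologicalSpace G] [T2Space G] [CompactSpace G] [ChartedSpace E G] [Group G]
    [LieGroup 𝓘(ℝ, E) ∞ G] [LieAlgebra.IsSemisimple ℝ (GroupLieAlgebra 𝓘(ℝ, E) G)]
    (S : AffHermitian.HermitianSymmetric (GroupLieAlgebra 𝓘(ℝ, E) G)) :
    -- the normalization factor, and invariance of the metric: every coframe is an isometry
    S.chi = Module.finrank ℝ S.m ∧
    (∀ (g : G) (X Y : GroupLieAlgebra 𝓘(ℝ, E) G),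
      AffHermitian.affInner (AffHermitian.coframe g X) (AffHermitian.coframe g Y) =
        AffHermitian.metric X Y) ∧
    -- the curve flows of the class determined by `χ^{-1/2} (0, A)`
    (∀ γ : ℝ → ℝ → AffHermitian.Aff E G, AffHermitian.SmoothFlow γ →
      (∀ x t, ∃ g : G, AffHermitian.coframe g (AffHermitian.tangentX γ x t) = S.e) →
      -- they are non-stretching, with `x` the arclength
      (∀ x t, AffHermitian.metric (AffHermitian.tangentX γ x t) (AffHermitian.tangentX γ x t) = 1) ∧
      -- they have a `G`-parallel framing
      (∃ ψ : ℝ → ℝ → G, AffHermitian.IsGParallelFraming S γ ψ) ∧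
      (∀ ψ : ℝ → ℝ → G, AffHermitian.IsGParallelFraming S γ ψ →
        -- the variables of the framing, and its structure equations
        (∃! V : AffHermitian.FrameVars E G, V.Valued S ∧ V.Represents γ ψ) ∧
        AffHermitian.StructureEqs
          (fun x t => AffHermitian.coframe (ψ x t) (AffHermitian.tangentX γ x t))
          (fun x t => AffHermitian.coframe (ψ x t) (AffHermitian.tangentT γ x t))
          (AffHermitian.connX E ψ) (AffHermitian.connT E ψ) ∧
        (∀ V : AffHermitian.FrameVars E G, V.Valued S → V.Represents γ ψ →
          V.Smooth ∧ V.FlowEqs S) ∧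
        -- the equivalence group is `H`, the stabilizer of `A`
        {k : G | AffHermitian.IsGParallelFraming S γ (fun x t => ψ x t * k)} =
          AffHermitian.stabilizer E S.A ∧
        (∀ g : ℝ → ℝ → G, AffHermitian.SmoothGroup E g →
          (AffHermitian.IsGParallelFraming S γ (fun x t => ψ x t * g x t) ↔
            (∀ x t, g x t ∈ AffHermitian.stabilizer E S.A) ∧ ∀ x x' t, g x t = g x' t)) ∧
        (∀ k ∈ AffHermitian.stabilizer E S.A, ∀ V : AffHermitian.FrameVars E G,
          V.Represents γ ψ → (V.act k⁻¹).Represents γ (fun x t => ψ x t * k)) ∧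
        -- closed curves: the framing is periodic up to the equivalence group
        (∀ l : ℝ, (∀ x t, γ (x + l) t = γ x t) →
          ∀ t, ∃ k ∈ AffHermitian.stabilizer E S.A, ∀ x, ψ (x + l) t = ψ x t * k))) ∧
    -- the structure equations reduce to the four flow equations
    (∀ V : AffHermitian.FrameVars E G, V.Valued S → V.Smooth →
      (AffHermitian.StructureEqs (fun _ _ => S.e) (fun x t => (0, V.hpar x t + V.hperp x t))
          (fun x t => (V.q x t, 0)) (fun x t => (V.wpar x t + V.wperp x t, 0)) ↔
        V.FlowEqs S)) ∧
    -- the flow equations are invariant under `H`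
    (∀ k ∈ AffHermitian.stabilizer E S.A, ∀ V : AffHermitian.FrameVars E G, V.Valued S →
      V.Smooth → (V.act k).Valued S ∧ (V.act k).Smooth ∧ (V.FlowEqs S ↔ (V.act k).FlowEqs S)) :=
  mainTheorem12_general S
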